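/- **Theorem 4 (Analytic trace formula).** Let $p$ be a prime, $q=p^a$ with $a\ge 1$, and let $f_0,f_1,f_2,\dots\in\mathbb{F}_q[x]$ be polynomials of bounded degree with $\deg f_0>0$. Write $f_i=\sum_u a_{iu}x^u$. For $k\ge1$ let $\mathbb{Z}_{q^k}=W(\mathbb{F}_{q^k})$ be the ring of integers of the unramified extension $\mathbb{Q}_{q^k}$ of $\mathbb{Q}_p$ of degree $ak$, and $\mu_{q^k-1}\subset\mathbb{Z}_{q^k}$ the group of $(q^k-1)$-th roots of unity. Let $\hat c$ denote the Teichmüller lift of $c$, and put $\hat f_i(x)=\sum_u\widehat{a_{iu}}\,x^u$, $\hat f(x)=\sum_{i\ge0}p^i\hat f_i(x)$, $$S_f(T,k)=\sum_{x\in\mu_{q^k-1}}(1+T)^{\mathrm{Tr}_{\mathbb{Q}_{q^k}/\mathbb{Q}_p}(\hat f(x))}\in\mathbb{Z}_p[[T]],\qquad C_f(T,s)=\exp\Bigl(-\sum_{k\ge1}\frac{S_f(T,k)}{q^k-1}\,\frac{s^k}{k}\Bigr)\in\mathbb{Q}_p[[T]][[s]].$$ Let $E(X)=\exp\bigl(\sum_{i\ge0}X^{p^i}/p^i\bigr)\in\mathbb{Z}_p[[X]]$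 be the Artin–Hasse series, let $\pi_i\in T\,\mathbb{Z}_p[[T]]$ be the series with $E(\pi_i)=(1+T)^{p^i}$, and let $$E_f(x)=\prod_{i\ge0}\ \prod_{u=0}^{\deg f_i}E(\pi_i\,\widehat{a_{iu}}\,x^u)\in\mathbb{Z}_q[[T]][[x]].$$ Let $\sigma$ be the Frobenius automorphism of $\mathbb{Z}_q$, acting on the coefficients of $\mathbb{Z}_q[[T]][[x]]$ (with $\sigma(T)=T$, $\sigma(x)=x$), let $\varphi_p(\sum_u b_ux^u)=\sum_u b_{pu}x^u$, and let $\varphi=\sigma^{-1}\circ\varphi_p\circ E_f(x)$, where $E_f(x)$ stands for multiplication by $E_f(x)$. Let $M$ be the matrix of $\varphi$ with respect to $1,x,x^2,\dots$ and let $M^a$ denote the matrix of the ($\mathbb{Z}_q[[T]]$-linear) iterate $\varphi^a$ with respect to $1,x,x^2,\dots$; as $\varphi$ is $\sigma^{-1}$-semilinear, this is the product $M\cdot\sigma^{-1}(M)\cdots\sigma^{-(a-1)}(M)$. Then the product defining $E_f(x)$ converges (coefficientwise $p$-adically); the determinant $$\det(I-sM^a)=\sum_{n\ge0}(-1)^n\Bigl(\sum_{S\subset\mathbb{N},\,|S|=n}\det\bigl((M^a)_{u,v}\bigr)_{u,v\in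 S}\Bigr)s^n$$ exists, i.e. all the inner sums converge $T$-adically; $C_f(T,s)$ has coefficients in $\mathbb{Z}_p[[T]]$; and $$C_f(T,s)=\det(I-sM^a)\quad\text{in }\mathbb{Z}_q[[T]][[s]].$$ Moreover $C_f(T,s)=\sum_n b_n(T)s^n$ is $T$-adically analytic (entire) in $s$: $\operatorname{ord}_T(b_n)/n\to\infty$ as $n\to\infty$. -/

import Mathlib

open PowerSeries

namespace TAdicWitt
section ArtinHasse
variable (p : ℕ) [Fact p.Prime]

/-- A `p`-adic number of norm at most one, as a `p`-adic integer. -/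
def padicIntMk (x : ℚ_[p]) (hx : ‖x‖ ≤ 1) : ℤ_[p] := ⟨x, hx⟩

/-- The series `∑_{i ≥ 0} X ^ (p ^ i) / p ^ i`. -/
noncomputable def ahLog : ℚ_[p]⟦X⟧ :=
  open scoped Classical in
  PowerSeries.mk fun n => if ∃ i : ℕ, n = p ^ i then (n : ℚ_[p])⁻¹ else 0

/-- The Artin-Hasse series `exp (∑_{i ≥ 0} X ^ (p ^ i) / p ^ i)` over `ℚ_p`. -/
noncomputable def artinHasseQ : ℚ_[p]⟦X⟧ :=
  (PowerSeries.exp ℚ_[p]).subst (ahLog p)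

theorem ahLog_zero : constantCoeff (ahLog p) = 0 := by
  have hp := (Fact.out : p.Prime)
  rw [← coeff_zero_eq_constantCoeff_apply, ahLog, coeff_mk, if_neg]
  rintro ⟨i, hi⟩
  exact (pow_pos hp.pos i).ne hi

theorem ode_unique {F G H : ℚ_[p]⟦X⟧} (hF : derivative ℚ_[p] F = H * F)
    (hG : derivative ℚ_[p] G = H * G) (h0 : constantCoeff F = constantCoeff G) : F = G := by
  ext n
  induction n using Nat.strong_induction_on with
  | _ n ih =>
    cases n with
    | zero => simpa using h0
    | succ n =>
      have e1 := congrArg (coeff n) hF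
      have e2 := congrArg (coeff n) hG
      rw [coeff_derivative, coeff_mul] at e1 e2
      have : ∑ x ∈ Finset.HasAntidiagonal.antidiagonal n, coeff x.1 H * coeff x.2 F
          = ∑ x ∈ Finset.HasAntidiagonal.antidiagonal n, coeff x.1 H * coeff x.2 G := by
        refine Finset.sum_congr rfl fun x hx => ?_
        rw [ih x.2 (by have := Finset.HasAntidiagonal.mem_antidiagonal.1 hx; omega)]
      rw [this, ← e2] at e1
      exact mul_right_cancel₀ (by exact_mod_cast n.succ_ne_zero) e1

theorem artinHasseQ_zero : constantCoeff (artinHasseQ p) = 1 := by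
  rw [artinHasseQ, ← coeff_zero_eq_constantCoeff_apply,
    coeff_subst' (HasSubst.of_constantCoeff_zero' (ahLog_zero p)),
    finsum_eq_single _ 0]
  · simp
  · intro n hn
    simp [ahLog_zero, hn]

theorem derivative_artinHasseQ :
    derivative ℚ_[p] (artinHasseQ p) = derivative ℚ_[p] (ahLog p) * artinHasseQ p := by
  rw [artinHasseQ, derivative_subst (HasSubst.of_constantCoeff_zero' (ahLog_zero p)),
    derivative_exp, mul_comm]

theorem ahLog_expand : (p : ℚ_[p]⟦X⟧) * ahLog p =
    expand p (Fact.out : p.Prime).ne_zero (ahLog p) + (p : ℚ_[p]⟦X⟧) * X := by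
  have hp := (Fact.out : p.Prime)
  have hp0 : (p : ℚ_[p]) ≠ 0 := by exact_mod_cast hp.ne_zero
  ext n
  have hc : (p : ℚ_[p]⟦X⟧) = C (p : ℚ_[p]) := by simp
  rw [map_add, hc, coeff_C_mul, coeff_C_mul, coeff_expand, coeff_X, ahLog]
  simp only [coeff_mk]
  by_cases h1 : n = 1
  · subst h1
    rw [if_pos ⟨0, by simp⟩, if_neg (by simpa using hp.ne_one)]
    simp
  · by_cases h : ∃ i, n = p ^ i
    · obtain ⟨i, rfl⟩ := h
      cases i with
      | zero => simp at h1
      | succ i =>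
        rw [if_pos ⟨i + 1, rfl⟩, if_pos (dvd_pow_self p i.succ_ne_zero), if_neg h1]
        have : p ^ (i + 1) / p = p ^ i := by
          rw [pow_succ, Nat.mul_div_cancel _ hp.pos]
        rw [this, if_pos ⟨i, rfl⟩]
        push_cast
        field_simp
        ring
    · rw [if_neg h, if_neg h1]
      split_ifs with h2 h3
      · obtain ⟨i, hi⟩ := h3
        exact (h ⟨i + 1, by rw [pow_succ, ← hi, Nat.div_mul_cancel h2]⟩).elim
      · simp
      · simp

theorem artinHasseQ_pow : artinHasseQ p ^ p =
    expand p (Fact.out : p.Prime).ne_zero (artinHasseQ p) *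
      rescale (p : ℚ_[p]) (PowerSeries.exp ℚ_[p]) := by
  have hp := (Fact.out : p.Prime)
  have hs : HasSubst (X ^ p : ℚ_[p]⟦X⟧) := HasSubst.X_pow hp.ne_zero
  have hs' : HasSubst ((p : ℚ_[p]) • X : ℚ_[p]⟦X⟧) := HasSubst.smul_X' _
  have hl := congrArg (derivative ℚ_[p]) (ahLog_expand p)
  have hc : (p : ℚ_[p]⟦X⟧) = C (p : ℚ_[p]) := by simp
  refine ode_unique p (H := (p : ℚ_[p]⟦X⟧) * derivative ℚ_[p] (ahLog p)) ?_ ?_ ?_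
  · rw [Derivation.leibniz_pow, derivative_artinHasseQ]
    rw [← mul_pow_sub_one hp.ne_zero (artinHasseQ p)]
    simp only [nsmul_eq_mul, smul_eq_mul]
    ring
  · have h1 : (p : ℚ_[p]⟦X⟧) * derivative ℚ_[p] (ahLog p) =
        derivative ℚ_[p] (expand p hp.ne_zero (ahLog p)) + (p : ℚ_[p]⟦X⟧) := by
      simpa [Derivation.leibniz] using hl
    rw [h1, Derivation.leibniz, rescale_eq_subst, derivative_subst hs', derivative_exp,
      expand_apply, expand_apply, derivative_subst hs, derivative_subst hs,
      derivative_artinHasseQ, subst_mul hs]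
    have h2 : derivative ℚ_[p] ((p : ℚ_[p]) • X : ℚ_[p]⟦X⟧) = (p : ℚ_[p]⟦X⟧) := by
      rw [Derivation.map_smul, derivative_X, smul_eq_C_mul, mul_one, hc]
    rw [h2]
    simp only [smul_eq_mul]
    ring
  · rw [map_mul, map_pow, constantCoeff_expand, artinHasseQ_zero,
      ← coeff_zero_eq_constantCoeff_apply, coeff_rescale]
    simp

theorem norm_pow_div_factorial {j : ℕ} (hj : j ≠ 0) :
    ‖(p : ℚ_[p]) ^ j * (1 / (j.factorial : ℚ_[p]))‖ ≤ ‖(p : ℚ_[p])‖ := by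
  have hp := (Fact.out : p.Prime)
  have hv : padicValNat p j.factorial < j := padicValNat_factorial_lt_of_ne_zero p hj
  have hn : ‖(j.factorial : ℚ_[p])‖ = (p : ℝ) ^ (-(padicValNat p j.factorial : ℤ)) := by
    rw [Padic.norm_eq_zpow_neg_valuation (by exact_mod_cast j.factorial_ne_zero)]
    simp
  have hp1 : (1 : ℝ) < p := by exact_mod_cast hp.one_lt
  rw [norm_mul, norm_div, hn, norm_pow, Padic.norm_p, norm_one, one_div, ← zpow_neg, neg_neg,
    ← zpow_natCast, inv_zpow', ← zpow_add₀ (by positivity), ← zpow_neg_one]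
  exact zpow_le_zpow_right₀ hp1.le (by omega)

/-- The Artin-Hasse series has `p`-integral coefficients. -/
theorem norm_coeff_artinHasseQ_le (n : ℕ) : ‖coeff n (artinHasseQ p)‖ ≤ 1 := by
  have hp := (Fact.out : p.Prime)
  induction n using Nat.strong_induction_on with
  | _ n ih =>
    rcases Nat.eq_zero_or_pos n with rfl | hn
    · simp [artinHasseQ_zero]
    set P : ℤ_[p]⟦X⟧ := PowerSeries.mk fun m =>
      if h : m < n then padicIntMk p (coeff m (artinHasseQ p)) (ih m h) else 0 with hP
    set ι : ℤ_[p] →+* ℚ_[p] := PadicInt.Coe.ringHom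
    have hPc : ∀ m, m < n → ι (coeff m P) = coeff m (artinHasseQ p) := by
      intro m hm
      rw [hP, coeff_mk, dif_pos hm]
      rfl
    have hι : ∀ z : ℤ_[p], ‖ι z‖ ≤ 1 := fun z => z.2
    obtain ⟨R, hR⟩ : X ^ n ∣ artinHasseQ p - PowerSeries.map ι P := by
      rw [X_pow_dvd_iff]
      intro m hm
      simp [hPc m hm]
    have hR0 : constantCoeff R = coeff n (artinHasseQ p) := by
      have := congrArg (coeff n) hR
      rw [coeff_X_pow_mul', if_pos le_rfl] at this
      simpa [hP] using this.symm
    have hE : artinHasseQ p = PowerSeries.map ι P + X ^ n * R := by rw [← hR]; ring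
    have hpow := artinHasseQ_pow p
    obtain ⟨k, hk⟩ := Polynomial.powAddExpansion (PowerSeries.map ι P) (X ^ n * R) p
    -- the coefficient of the left-hand side
    have hL : coeff n (artinHasseQ p ^ p) =
        ι (coeff n (P ^ p)) + (p : ℚ_[p]) * coeff n (artinHasseQ p) := by
      rw [hE, hk]
      have e1 : (p : ℚ_[p]⟦X⟧) * (PowerSeries.map ι P) ^ (p - 1) * (X ^ n * R) =
          X ^ n * (C (p : ℚ_[p]) * ((PowerSeries.map ι P) ^ (p - 1) * R)) := by
        simp; ring
      have e2 : k * (X ^ n * R) ^ 2 = X ^ (n + 1) * (X ^ (n - 1) * (k * R ^ 2)) := by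
        rw [← mul_assoc (X ^ (n + 1)), ← pow_add, show n + 1 + (n - 1) = n * 2 by omega]
        ring
      rw [e1, e2, map_add, map_add, ← map_pow, coeff_map, coeff_X_pow_mul', if_pos le_rfl,
        coeff_X_pow_mul', if_neg (by omega), ← hE]
      have hP0 : ι (constantCoeff P) = 1 := by
        rw [← coeff_zero_eq_constantCoeff_apply, hPc 0 hn]
        simp [artinHasseQ_zero]
      have hP0' : constantCoeff (PowerSeries.map ι P) = 1 := by
        rw [← coeff_zero_eq_constantCoeff_apply, coeff_map]
        simpa using hP0
      simp only [Nat.sub_self, coeff_zero_eq_constantCoeff_apply, map_mul, map_pow, hP0', hR0]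
      simp
    have hexp : ∀ i, i ≤ n → coeff i (expand p hp.ne_zero (artinHasseQ p)) =
        ι (coeff i (expand p hp.ne_zero P)) := by
      intro i hi
      rw [coeff_expand, coeff_expand]
      split_ifs with h
      · rw [hPc]
        rcases Nat.eq_zero_or_pos i with rfl | hi0
        · simpa using hn
        · exact (Nat.div_lt_self hi0 hp.one_lt).trans_le hi
      · simp
    -- the Frobenius congruence
    have hfrob : ‖ι (coeff n (expand p hp.ne_zero P) - coeff n (P ^ p))‖ ≤ ‖(p : ℚ_[p])‖ := by
      have hz : PadicInt.toZMod (coeff n (expand p hp.ne_zero P) - coeff n (P ^ p)) = 0 := by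
        rw [map_sub, ← coeff_map, ← coeff_map, map_expand, map_pow, sub_eq_zero]
        have := MvPowerSeries.map_frobenius_expand (R := ZMod p) (σ := Unit) p hp.ne_zero
          (f := PowerSeries.map PadicInt.toZMod P)
        rw [ZMod.frobenius_zmod] at this
        rw [← this]
        rfl
      have hm := (PadicInt.ker_toZMod (p := p)) ▸ (RingHom.mem_ker.2 hz)
      rw [PadicInt.maximalIdeal_eq_span_p, Ideal.mem_span_singleton] at hm
      obtain ⟨c, hc⟩ := hm
      rw [hc, map_mul, map_natCast, norm_mul]
      exact mul_le_of_le_one_right (norm_nonneg _) (hι c)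
    have hRHS : ‖coeff n (artinHasseQ p ^ p) - ι (coeff n (expand p hp.ne_zero P))‖
        ≤ ‖(p : ℚ_[p])‖ := by
      rw [hpow, coeff_mul, ← Finset.add_sum_erase _ _
        (Finset.HasAntidiagonal.mem_antidiagonal.2 (add_zero n) : ((n, 0) : ℕ × ℕ) ∈ _)]
      have h0 : coeff 0 (rescale (p : ℚ_[p]) (PowerSeries.exp ℚ_[p])) = 1 := by
        simp [coeff_rescale]
      rw [h0, mul_one, hexp n le_rfl, add_sub_cancel_left]
      refine IsUltrametricDist.norm_sum_le_of_forall_le_of_nonneg (norm_nonneg _) fun x hx => ?_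
      obtain ⟨hx1, hx2⟩ := Finset.mem_erase.1 hx
      have hx3 := Finset.HasAntidiagonal.mem_antidiagonal.1 hx2
      have hx4 : x.2 ≠ 0 := fun h => hx1 (Prod.ext (by simp; omega) h)
      rw [hexp x.1 (by omega), norm_mul, coeff_rescale, coeff_exp]
      refine (mul_le_of_le_one_left (norm_nonneg _) (hι _)).trans ?_
      simpa using norm_pow_div_factorial p hx4
    have : ‖(p : ℚ_[p]) * coeff n (artinHasseQ p)‖ ≤ ‖(p : ℚ_[p])‖ := by
      have e : (p : ℚ_[p]) * coeff n (artinHasseQ p) =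
        (coeff n (artinHasseQ p ^ p) - ι (coeff n (expand p hp.ne_zero P))) +
          ι (coeff n (expand p hp.ne_zero P) - coeff n (P ^ p)) := by
        rw [hL, map_sub]; ring
      rw [e]
      exact (Padic.nonarchimedean _ _).trans (max_le hRHS hfrob)
    rw [norm_mul] at this
    have hpp : 0 < ‖(p : ℚ_[p])‖ := norm_pos_iff.2 (by exact_mod_cast hp.ne_zero)
    exact (mul_le_iff_le_one_right hpp).1 this

/-- The Artin-Hasse series `E(X)` as an element of `ℤ_p⟦X⟧`. -/
noncomputable def artinHasse : ℤ_[p]⟦X⟧ :=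
  PowerSeries.mk fun n =>
    padicIntMk p (coeff n (artinHasseQ p)) (norm_coeff_artinHasseQ_le p n)

theorem isUnit_coeff_one_artinHasse : IsUnit (coeff 1 (artinHasse p - 1)) := by
  have h : coeff 1 (artinHasseQ p) = 1 := by
    have h1 := congrArg (coeff 0) (derivative_artinHasseQ p)
    rw [coeff_derivative, coeff_mul] at h1
    simp only [zero_add, Finset.HasAntidiagonal.antidiagonal_zero, Finset.sum_singleton] at h1
    rw [coeff_derivative, ahLog, coeff_mk, if_pos ⟨0, by simp⟩] at h1
    simpa [artinHasseQ_zero] using h1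
  have h2 : coeff 1 (artinHasse p) = 1 := by
    rw [artinHasse, coeff_mk]
    exact Subtype.ext h
  rw [map_sub, h2, coeff_one, if_neg one_ne_zero, sub_zero]
  exact isUnit_one

/-- `π_i`, the power series in `T` without constant term with `E(π_i) = (1 + T) ^ (p ^ i)`:
the compositional inverse of `E(X) - 1`, evaluated at `(1 + T) ^ (p ^ i) - 1`. -/
noncomputable def piSeries (i : ℕ) : ℤ_[p]⟦X⟧ :=
  (substInvOfIsUnit (artinHasse p - 1) (isUnit_coeff_one_artinHasse p)).subst
    ((1 + X) ^ p ^ i - 1 : ℤ_[p]⟦X⟧)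

end ArtinHasse

section WittRing

variable (p : ℕ) [Fact p.Prime] {K : Type*} [Field K] [CharP K p]

/-- The canonical map `ℤ_p = W(𝔽_p) → W(K)`. -/
noncomputable def padicIntToWitt : ℤ_[p] →+* WittVector p K :=
  (WittVector.map (ZMod.castHom (dvd_refl p) K)).comp
    ((WittVector.equiv p).symm : ℤ_[p] →+* WittVector p (ZMod p))

/-- The trace `W(K) → ℤ_p`, for `K` a finite field: the trace of the finite free
`ℤ_p`-algebra `W(K)`. -/
noncomputable def wittTrace (y : WittVector p K) : ℤ_[p] :=
  letI : Algebra ℤ_[p] (WittVector p K) := (padicIntToWitt p).toAlgebra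
  Algebra.trace ℤ_[p] (WittVector p K) y

/-- The `p`-adic topology of `W(K)`. -/
@[reducible]
noncomputable def wittTopology (p : ℕ) [Fact p.Prime] (K : Type*) [Field K] :
    TopologicalSpace (WittVector p K) :=
  (Ideal.span {(p : WittVector p K)}).adicTopology

/-- The coefficientwise lift of a polynomial by Teichmüller representatives. -/
noncomputable def teichPoly (h : Polynomial K) : Polynomial (WittVector p K) :=
  h.sum fun u c => Polynomial.monomial u (WittVector.teichmuller p c)

/-- The value `∑_i p ^ i * f̂_i(x)` at a point `x` of `W(L)`, for an extension `L` of `K`. -/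
noncomputable def fHat {L : Type*} [Field L] [CharP L p] [Algebra K L] (f : ℕ → Polynomial K)
    (x : WittVector p L) : WittVector p L :=
  letI : TopologicalSpace (WittVector p L) := wittTopology p L
  ∑' i : ℕ, (p : WittVector p L) ^ i *
    (teichPoly p (f i)).eval₂ (WittVector.map (algebraMap K L)) x

end WittRing

section ExponentialSum

variable (p : ℕ) [Fact p.Prime] {K : Type*} [Field K] [Finite K] [CharP K p]

instance charP_extension (k : ℕ) [NeZero k] : CharP (FiniteField.Extension K p k) p :=
  charP_of_injective_algebraMap (algebraMap K (FiniteField.Extension K p k)).injective p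

/-- The `T`-adic exponential sum `S_f(T, k)`: the sum of `(1 + T) ^ Tr(f̂(x))` over the roots of
unity `x` of order dividing `q ^ k - 1` in `W(𝔽_{q^k})`, where `K = 𝔽_q`. -/
noncomputable def expSum (f : ℕ → Polynomial K) (k : ℕ) [NeZero k] : ℤ_[p]⟦X⟧ :=
  ∑ x ∈ Polynomial.nthRootsFinset (Nat.card K ^ k - 1)
      (1 : WittVector p (FiniteField.Extension K p k)),
    binomialSeries ℤ_[p] (wittTrace p (fHat p f x))

/-- The series `-∑_{k ≥ 1} S_f(T, k) s ^ k / (k (q ^ k - 1))` in `s` over `ℚ_p⟦T⟧`. -/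
noncomputable def cExponent (f : ℕ → Polynomial K) : ℚ_[p]⟦X⟧⟦X⟧ :=
  PowerSeries.mk fun
    | 0 => 0
    | k + 1 => -(C (((k + 1 : ℕ) : ℚ_[p]) * ((Nat.card K : ℚ_[p]) ^ (k + 1) - 1))⁻¹ *
        PowerSeries.map PadicInt.Coe.ringHom (expSum p f (k + 1)))

/-- The function `C_f(T, s)`, a power series in `s` over `ℚ_p⟦T⟧`. -/
noncomputable def cFunction (f : ℕ → Polynomial K) : ℚ_[p]⟦X⟧⟦X⟧ :=
  (PowerSeries.exp ℚ_[p]⟦X⟧).subst (cExponent p f)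

end ExponentialSum

section Dwork

variable (p : ℕ) [Fact p.Prime] {K : Type*} [Field K] [CharP K p]

open scoped PowerSeries.WithPiTopology

/-- The value `E(y) = ∑_n e_n y ^ n` of the Artin-Hasse series at an element `y` of
`W(K)⟦T⟧⟦x⟧`, a ring with the topology of coefficientwise `p`-adic convergence. -/
noncomputable def artinHasseEval (y : (WittVector p K)⟦X⟧⟦X⟧) : (WittVector p K)⟦X⟧⟦X⟧ :=
  letI : TopologicalSpace (WittVector p K) := wittTopology p K
  ∑' n : ℕ, C (C (padicIntToWitt p (coeff n (artinHasse p)))) * y ^ n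

/-- `E_h(x, η) = ∏_u E(η ĥ_u x ^ u)` for a polynomial `h` and `η` in `ℤ_p⟦T⟧`. -/
noncomputable def splitFactor (h : Polynomial K) (η : ℤ_[p]⟦X⟧) : (WittVector p K)⟦X⟧⟦X⟧ :=
  ∏ u ∈ Finset.range (h.natDegree + 1),
    artinHasseEval p (C (PowerSeries.map (padicIntToWitt p) η *
      C (WittVector.teichmuller p (h.coeff u))) * X ^ u)

/-- Convergence of the product `E_f(x) = ∏_i E_{f_i}(x, π_i)`. -/
def SplitConverges (f : ℕ → Polynomial K) : Prop :=
  letI : TopologicalSpace (WittVector p K) := wittTopology p K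
  Multipliable fun i : ℕ => splitFactor p (f i) (piSeries p i)

/-- The series `E_f(x) = ∏_i E_{f_i}(x, π_i)` in `W(K)⟦T⟧⟦x⟧`. -/
noncomputable def splitSeries (f : ℕ → Polynomial K) : (WittVector p K)⟦X⟧⟦X⟧ :=
  letI : TopologicalSpace (WittVector p K) := wittTopology p K
  ∏' i : ℕ, splitFactor p (f i) (piSeries p i)

/-- The operator `∑ b_u x ^ u ↦ ∑ b_{pu} x ^ u`. -/
noncomputable def phiP {R : Type*} [CommRing R] (g : R⟦X⟧) : R⟦X⟧ :=
  PowerSeries.mk fun u => coeff (p * u) g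

/-- The Dwork operator `φ = σ⁻¹ ∘ φ_p ∘ E_f(x)` on `W(K)⟦T⟧⟦x⟧`, where `σ` is the Frobenius
automorphism of `W(K)`, acting on coefficients. -/
noncomputable def dworkOp [PerfectRing K p] (f : ℕ → Polynomial K)
    (g : (WittVector p K)⟦X⟧⟦X⟧) : (WittVector p K)⟦X⟧⟦X⟧ :=
  PowerSeries.map
    (PowerSeries.map ((WittVector.frobeniusEquiv p K).symm : WittVector p K →+* WittVector p K))
    (phiP p (splitSeries p f * g))

/-- The matrix of the `r`-th iterate of the Dwork operator in the basis `1, x, x ^ 2, …`: its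
`v`-th column holds the coefficients of `φ^r (x ^ v)`. The operator is `σ⁻¹`-semilinear, so the
matrix of `φ^r` is the product `M · σ⁻¹(M) ⋯ σ^{-(r-1)}(M)`, where `M` is the case `r = 1`. -/
noncomputable def dworkMatrix [PerfectRing K p] (f : ℕ → Polynomial K) (r : ℕ) :
    Matrix ℕ ℕ (WittVector p K)⟦X⟧ :=
  Matrix.of fun u v => coeff u ((dworkOp p f)^[r] (X ^ v))

end Dwork

section Fredholm

variable {R : Type*} [CommRing R]

/-- The principal minor of an infinite matrix on a finite set of indices. -/
noncomputable def principalMinor (A : Matrix ℕ ℕ R⟦X⟧) (S : Finset ℕ) : R⟦X⟧ :=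
  (A.submatrix (Subtype.val : S → ℕ) (Subtype.val : S → ℕ)).det

/-- Existence of `det (I - sA)`: for each `n` the sum of the principal minors of size `n`
converges `T`-adically. -/
def HasFredholmDet (A : Matrix ℕ ℕ R⟦X⟧) : Prop :=
  letI : TopologicalSpace R⟦X⟧ := (Ideal.span {(X : R⟦X⟧)}).adicTopology
  ∀ n : ℕ, Summable fun S : {S : Finset ℕ // S.card = n} => principalMinor A S

/-- The determinant `det (I - sA) = ∑_n (-1) ^ n (∑_{|S| = n} det A_S) s ^ n` of an infinite
matrix over `R⟦T⟧`. -/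
noncomputable def fredholmDet (A : Matrix ℕ ℕ R⟦X⟧) : R⟦X⟧⟦X⟧ :=
  letI : TopologicalSpace R⟦X⟧ := (Ideal.span {(X : R⟦X⟧)}).adicTopology
  PowerSeries.mk fun n =>
    (-1) ^ n * ∑' S : {S : Finset ℕ // S.card = n}, principalMinor A S

/-- A power series `∑ b_n(T) s ^ n` is `T`-adically analytic (entire) in `s` if
`ord_T (b_n) / n → ∞`, that is, if it converges `T`-adically at every `s`. -/
def IsTAdicEntire (F : R⟦X⟧⟦X⟧) : Prop :=
  ∀ c : ℕ, ∀ᶠ n : ℕ in Filter.atTop, ((c * n : ℕ) : ℕ∞) ≤ (coeff n F).order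

end Fredholm

end TAdicWitt

/-! Write q = p^a, let d bound the degrees of the f_i, and put F_r = ∏_{j<r} σ^j(E_f)(x^{p^j}).

Since π_i has no constant term, the coefficient of T^m in E(π_i ĉ x^u) is a polynomial in x of
degree at most um. Hence E_f lies in W(K)[x]⟦T⟧, with degree at most dm at T^m, and can be evaluated
at Teichmüller points. Moving all factors past φ_p and σ⁻¹ gives φ^r = σ^{-r} ∘ φ_p^r ∘ F_r
(`map_frobPow_coeff_dworkOp_iterate`). As σ^a = 1 on W(K), the (u, v) entry of the matrix of φ^{ak}
is the coefficient of x^{q^k u - v} in F_{ak}. By the degree bound, T^m occurs in entry (u, v) of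
the matrix of φ^a only if 2u ≤ dm + v (`decays_dworkMatrix`). Added up over the factors of a minor
on S, this yields ∑_{u ∈ S} u ≤ dm. So each coefficient of the determinant is a finite sum, and
since n distinct indices sum to at least n(n-1)/2, the determinant is entire.

The trace of φ^{ak} is the sum over u of the coefficients of x^{(q^k-1)u} in F_{ak}; by
orthogonality of characters, q^k - 1 times it is ∑ F_{ak}(t̂) over the nonzero t in 𝔽_{q^k}. Because
σ^j(t̂) = t̂^{p^j}, the value F_{ak}(t̂) is ∏_j σ^j(E_f(t̂)). The Artin-Hasse series has E'/E = ∑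
X^{p^i-1}, so a product of E(π y^{p^j}) over the Frobenius conjugates of a Teichmüller element y has
Tr(y) times the logarithmic derivative of E(π) (`prod_artinHasse_subst`). With E(π_i) = (1+T)^{p^i}
this gives F_{ak}(t̂) = (1+T)^{Tr f̂(t̂)}, whence S_f(T, k) = (q^k - 1) Tr(φ^{ak})
(`card_sub_one_mul_dworkTrace`).

Finally, Newton's identities recover both C_f and the determinant from these traces. They require
division by n + 1, which is possible in W(K) because the determinant lives there, and therefore in
ℤ_p (`exists_common_coeff`). -/

namespace TAdicWitt

/-! ### Jacobi's formula and Newton's identities for finite matrices -/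

section FiniteNewton

theorem derivation_prod {R A ι : Type*} [CommRing R] [CommRing A] [Algebra R A] [DecidableEq ι]
    (δ : Derivation R A A) (s : Finset ι) (f : ι → A) :
    δ (∏ i ∈ s, f i) = ∑ i ∈ s, (∏ j ∈ s.erase i, f j) * δ (f i) := by
  induction s using Finset.induction_on with
  | empty => simp
  | insert a s ha ih =>
    rw [Finset.prod_insert ha, Derivation.leibniz, ih, Finset.sum_insert ha,
      Finset.erase_insert ha, smul_eq_mul, smul_eq_mul, Finset.mul_sum, add_comm]
    congr 1
    refine Finset.sum_congr rfl fun i hi => ?_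
    have hai : a ≠ i := fun h => ha (h ▸ hi)
    rw [Finset.erase_insert_of_ne hai, Finset.prod_insert (fun h => ha (Finset.mem_of_mem_erase h)),
      mul_assoc]

/-- Jacobi's formula. By Cramer's rule the i-th diagonal entry on the right is the determinant with
column i replaced by its derivative, so the trace is the Leibniz expansion column by column. -/
theorem derivation_det {R A n : Type*} [CommRing R] [CommRing A] [Algebra R A] [Fintype n]
    [DecidableEq n] (δ : Derivation R A A) (M : Matrix n n A) :
    δ M.det = (M.adjugate * M.map δ).trace := by
  have h : ∀ i, (M.adjugate * M.map δ) i i = (M.updateCol i fun j => δ (M j i)).det := by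
    intro i
    rw [← Matrix.cramer_apply, Matrix.cramer_eq_adjugate_mulVec]
    rfl
  simp only [Matrix.trace, Matrix.diag_apply, h, Matrix.det_apply]
  rw [map_sum, Finset.sum_comm]
  refine Finset.sum_congr rfl fun σ _ => ?_
  rw [← Finset.smul_sum, Units.smul_def, Units.smul_def, map_zsmul, derivation_prod]
  congr 1
  refine Finset.sum_congr rfl fun i _ => ?_
  rw [← Finset.prod_erase_mul _ _ (Finset.mem_univ i)]
  congr 1
  · refine Finset.prod_congr rfl fun j hj => ?_
    rw [Matrix.updateCol_ne (Finset.ne_of_mem_erase hj)]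
  · rw [Matrix.updateCol_self]

variable {R n : Type*} [CommRing R] [Fintype n] [DecidableEq n]

/-- Newton's identities for the coefficients of `det (1 - sA)`. -/
theorem newton_charpolyRev (A : Matrix n n R) (m : ℕ) :
    ((m : R) + 1) * A.charpolyRev.coeff (m + 1) =
      -∑ i ∈ Finset.range (m + 1), (A ^ (i + 1)).trace * A.charpolyRev.coeff (m - i) := by
  set M : Matrix n n (Polynomial R) := 1 - (Polynomial.X : Polynomial R) • A.map Polynomial.C
    with hM
  set N : ℕ → Matrix n n R := fun j => M.adjugate.map fun g => g.coeff j with hN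
  -- adj(M) · M = det(M) with M = 1 - sA, solved for adj(M): comparing coefficients of s gives a
  -- recursion for the coefficients `N j` of adj(M).
  have hadj : M.adjugate =
      (Polynomial.X : Polynomial R) • (M.adjugate * A.map Polynomial.C) + A.charpolyRev • 1 := by
    have h := Matrix.adjugate_mul M
    nth_rewrite 2 [hM] at h
    rw [mul_sub, mul_one, Matrix.mul_smul, sub_eq_iff_eq_add] at h
    rw [add_comm]
    exact h
  have hmul : ∀ j u v, ((M.adjugate * A.map Polynomial.C) u v).coeff j = (N j * A) u v := by
    intro j u v
    simp [Matrix.mul_apply, hN, Polynomial.finsetSum_coeff]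
  have hN0 : N 0 = A.charpolyRev.coeff 0 • 1 := by
    ext u v
    have := congrArg (fun B => (B u v).coeff 0) hadj
    simpa [hN, Matrix.one_apply, Polynomial.coeff_zero_eq_eval_zero, apply_ite] using this
  have hNs : ∀ j, N (j + 1) = N j * A + A.charpolyRev.coeff (j + 1) • 1 := by
    intro j
    ext u v
    have := congrArg (fun B => (B u v).coeff (j + 1)) hadj
    simp only [Matrix.add_apply, Matrix.smul_apply, smul_eq_mul, Polynomial.coeff_add,
      Polynomial.coeff_X_mul, hmul] at this
    rw [Matrix.add_apply, ← hmul, Matrix.smul_apply]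
    simp only [hN, Matrix.map_apply]
    rw [this, hmul]
    by_cases huv : u = v <;> simp [Matrix.one_apply, huv]
  have hNm : ∀ j, N j = ∑ i ∈ Finset.range (j + 1), A.charpolyRev.coeff (j - i) • A ^ i := by
    intro j
    induction j with
    | zero => simpa using hN0
    | succ j ih =>
      rw [hNs, ih, Finset.sum_range_succ' _ (j + 1), Finset.sum_mul]
      simp [pow_succ]
  -- The derivative of M is -A, so Jacobi's formula expresses the derivative of det(1 - sA) through
  -- the traces of `N m * A`. No division is involved.
  have hder := derivation_det (Polynomial.derivative' (R := R)) M
  have hδ : M.map (Polynomial.derivative' (R := R)) = -A.map Polynomial.C := by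
    ext u v : 2
    by_cases huv : u = v <;> simp [hM, huv]
  rw [hδ] at hder
  have hc := congrArg (fun g => g.coeff m) hder
  have hl : (Polynomial.derivative' (R := R) M.det).coeff m =
      A.charpolyRev.coeff (m + 1) * ((m : R) + 1) := by
    exact Polynomial.coeff_derivative A.charpolyRev m
  have hr : ((M.adjugate * -A.map Polynomial.C).trace).coeff m = -(N m * A).trace := by
    simp only [Matrix.trace, Matrix.diag_apply, Polynomial.finsetSum_coeff, mul_neg,
      Matrix.neg_apply, Polynomial.coeff_neg, hmul, Finset.sum_neg_distrib]
  simp only [hl, hr] at hc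
  rw [mul_comm, hc, hNm, Finset.sum_mul, Matrix.trace_sum]
  congr 1
  refine Finset.sum_congr rfl fun i _ => ?_
  rw [Matrix.smul_mul, Matrix.trace_smul, smul_eq_mul, pow_succ, mul_comm]

theorem coeff_charpolyRev_eq_sum_minors (M : Matrix n n R) (k : ℕ) :
    M.charpolyRev.coeff k = (-1) ^ k * ∑ s ∈ Finset.univ.powersetCard k,
      (M.submatrix (Subtype.val : s → n) (Subtype.val : s → n)).det := by
  have h : M.charpolyRev = (1 + (Polynomial.X : Polynomial R) • (-M).map Polynomial.C).det := by
    rw [Matrix.charpolyRev, sub_eq_add_neg, Matrix.map_neg _ (map_neg _), smul_neg]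
  rw [h, Matrix.coeff_det_one_add_X_smul_eq_sum_minors, Finset.mul_sum]
  refine Finset.sum_congr rfl fun s hs => ?_
  rw [Matrix.submatrix_neg, Pi.neg_apply, Pi.neg_apply, Matrix.det_neg, Fintype.card_coe,
    (Finset.mem_powersetCard.mp hs).2]

end FiniteNewton

/-! ### Fredholm determinants of decaying infinite matrices -/

section Fredholm

variable {R : Type*} [CommRing R]

theorem le_of_coeff_prod_ne_zero {ι : Type*} (s : Finset ι) (f : ι → R⟦X⟧) (c e : ι → ℕ) (d : ℕ)
    (h : ∀ i ∈ s, ∀ m, coeff m (f i) ≠ 0 → c i ≤ d * m + e i) (m : ℕ)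
    (hm : coeff m (∏ i ∈ s, f i) ≠ 0) : ∑ i ∈ s, c i ≤ d * m + ∑ i ∈ s, e i := by
  classical
  induction s using Finset.induction_on generalizing m with
  | empty => simp
  | insert a s ha ih =>
    rw [Finset.prod_insert ha, coeff_mul] at hm
    obtain ⟨⟨i, j⟩, hij, hne⟩ := Finset.exists_ne_zero_of_sum_ne_zero hm
    rw [Finset.HasAntidiagonal.mem_antidiagonal] at hij
    have h1 := h a (Finset.mem_insert_self a s) i (left_ne_zero_of_mul hne)
    have h2 := ih (fun i hi => h i (Finset.mem_insert_of_mem hi)) j (right_ne_zero_of_mul hne)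
    rw [Finset.sum_insert ha, Finset.sum_insert ha, ← hij]
    simp only at h1 h2 ⊢
    rw [mul_add]
    omega

/-- The decay of a matrix of power series that makes its Fredholm determinant entire. -/
def Decays (d : ℕ) (A : Matrix ℕ ℕ R⟦X⟧) : Prop :=
  ∀ u v m, coeff m (A u v) ≠ 0 → 2 * u ≤ d * m + v

variable {d : ℕ} {A : Matrix ℕ ℕ R⟦X⟧}

/-- In a term of the determinant rows and columns run over the same set S, so adding 2u ≤ dm + v
over the factors gives 2 ∑ u ≤ dm + ∑ u. The factor 2 in the decay leaves one copy of ∑ u after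
cancellation. -/
theorem Decays.sum_le_of_coeff_minor_ne_zero (hA : Decays d A) {S : Finset ℕ} {m : ℕ}
    (h : coeff m (principalMinor A S) ≠ 0) : ∑ u ∈ S, u ≤ d * m := by
  rw [principalMinor, Matrix.det_apply, map_sum] at h
  obtain ⟨σ, -, hσ⟩ := Finset.exists_ne_zero_of_sum_ne_zero h
  have hσ' : coeff m (∏ i : S, A (σ i) i) ≠ 0 := by
    intro h0
    apply hσ
    rw [Units.smul_def, map_zsmul]
    simp only [Matrix.submatrix_apply]
    rw [h0, smul_zero]
  have := le_of_coeff_prod_ne_zero Finset.univ (fun i : S => A (σ i) i)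
    (fun i => 2 * ((σ i : S) : ℕ)) (fun i => (i : ℕ)) d (fun i _ m hm => hA _ _ _ hm) m hσ'
  rw [← Finset.mul_sum, Equiv.sum_comp σ (fun i : S => (i : ℕ)),
    Finset.sum_coe_sort S (fun u => u)] at this
  omega

theorem Decays.subset_range_of_coeff_minor_ne_zero (hA : Decays d A) {S : Finset ℕ} {m : ℕ}
    (h : coeff m (principalMinor A S) ≠ 0) : S ⊆ Finset.range (d * m + 1) := fun _ hu =>
  Finset.mem_range_succ_iff.2 <|
    (Finset.single_le_sum (f := id) (fun _ _ => Nat.zero_le _) hu).trans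
      (hA.sum_le_of_coeff_minor_ne_zero h)

/-- A family of power series whose coefficients are locally finite is `X`-adically summable. -/
theorem hasSum_adic_of_coeff {ι : Type*} {f : ι → R⟦X⟧} {g : R⟦X⟧} (T : ℕ → Finset ι)
    (h : ∀ m, ∀ i ∉ T m, coeff m (f i) = 0) (hg : ∀ m, coeff m g = ∑ i ∈ T m, coeff m (f i)) :
    letI : TopologicalSpace R⟦X⟧ := (Ideal.span {(X : R⟦X⟧)}).adicTopology
    HasSum f g := by
  classical
  let : TopologicalSpace R⟦X⟧ := (Ideal.span {(X : R⟦X⟧)}).adicTopology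
  refine ((Ideal.span {(X : R⟦X⟧)}).hasBasis_nhds_adic g).tendsto_right_iff.2 fun N _ => ?_
  refine Filter.eventually_atTop.2 ⟨(Finset.range N).biUnion T, fun s hs => ?_⟩
  refine ⟨∑ i ∈ s, f i - g, ?_, by simp⟩
  rw [Ideal.span_singleton_pow, SetLike.mem_coe, Ideal.mem_span_singleton, X_pow_dvd_iff]
  intro m hm
  rw [map_sub, map_sum, hg, sub_eq_zero]
  refine (Finset.sum_subset (fun i hi => hs (Finset.mem_biUnion.2 ⟨m, by simpa using hm, hi⟩))
    fun i _ hi => h m i hi).symm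

theorem t2Space_adic_X :
    @T2Space R⟦X⟧ (Ideal.span {(X : R⟦X⟧)}).adicTopology := by
  let : TopologicalSpace R⟦X⟧ := (Ideal.span {(X : R⟦X⟧)}).adicTopology
  have := (Ideal.span {(X : R⟦X⟧)}).nonarchimedean
  exact (IsAdic.isHausdorff_iff rfl).1 (inferInstance : IsHausdorff (Ideal.span {(X : R⟦X⟧)}) R⟦X⟧)

theorem Decays.hasSum_minors (hA : Decays d A) (n : ℕ) :
    letI : TopologicalSpace R⟦X⟧ := (Ideal.span {(X : R⟦X⟧)}).adicTopology
    HasSum (fun S : {S : Finset ℕ // S.card = n} => principalMinor A S)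
      (PowerSeries.mk fun m => ∑ S ∈ (Finset.range (d * m + 1)).powersetCard n,
        coeff m (principalMinor A S)) := by
  refine hasSum_adic_of_coeff (fun m => ((Finset.range (d * m + 1)).powerset).subtype _) ?_ ?_
  · intro m S hS
    by_contra h
    exact hS (by simpa using hA.subset_range_of_coeff_minor_ne_zero h)
  · intro m
    rw [coeff_mk, Finset.sum_subtype_eq_sum_filter (f := fun S => coeff m (principalMinor A S)),
      Finset.powersetCard_eq_filter]

theorem Decays.hasFredholmDet (hA : Decays d A) : HasFredholmDet A := fun n =>
  let : TopologicalSpace R⟦X⟧ := (Ideal.span {(X : R⟦X⟧)}).adicTopology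
  (hA.hasSum_minors n).summable

theorem Decays.coeff_coeff_fredholmDet (hA : Decays d A) (n : ℕ) {m r : ℕ} (hr : d * m < r) :
    coeff m (coeff n (fredholmDet A)) =
      (-1) ^ n * ∑ S ∈ (Finset.range r).powersetCard n, coeff m (principalMinor A S) := by
  let : TopologicalSpace R⟦X⟧ := (Ideal.span {(X : R⟦X⟧)}).adicTopology
  have := t2Space_adic_X (R := R)
  have h1 : ((-1) ^ n : R⟦X⟧) = C ((-1) ^ n) := by simp
  rw [fredholmDet, coeff_mk, (hA.hasSum_minors n).tsum_eq, h1, coeff_C_mul, coeff_mk]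
  congr 1
  refine Finset.sum_subset
    (Finset.powersetCard_mono (Finset.range_subset_range.2 hr)) fun S hS hS' => ?_
  by_contra h
  exact hS' (Finset.mem_powersetCard.2
    ⟨hA.subset_range_of_coeff_minor_ne_zero h, (Finset.mem_powersetCard.1 hS).2⟩)

/-- Quadratic growth in the cardinality is what makes the determinant entire. In the induction the
maximum of S is at least the number of the other elements. -/
theorem card_mul_pred_le_two_mul_sum (S : Finset ℕ) :
    S.card * (S.card - 1) ≤ 2 * ∑ u ∈ S, u := by
  induction S using Finset.induction_on_max with
  | empty => simp
  | insert a s hs ih =>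
    have ha : a ∉ s := fun h => (hs a h).false
    have hc : s.card ≤ a := by
      simpa using Finset.card_le_card (fun x hx => Finset.mem_range.2 (hs x hx) : s ⊆ .range a)
    rw [Finset.card_insert_of_notMem ha, Finset.sum_insert ha, Nat.add_sub_cancel]
    cases h : s.card with
    | zero => simp
    | succ c =>
      rw [h] at ih hc
      simp only [Nat.add_sub_cancel] at ih
      nlinarith

theorem Decays.coeff_coeff_fredholmDet_eq_zero (hA : Decays d A) {n m : ℕ}
    (h : 2 * (d * m) < n * (n - 1)) : coeff m (coeff n (fredholmDet A)) = 0 := by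
  rw [hA.coeff_coeff_fredholmDet n (Nat.lt_succ_self _), Finset.sum_eq_zero, mul_zero]
  intro S hS
  by_contra h0
  have h1 := hA.sum_le_of_coeff_minor_ne_zero h0
  have h2 := card_mul_pred_le_two_mul_sum S
  rw [(Finset.mem_powersetCard.1 hS).2] at h2
  omega

/-- The finite upper left corner of an infinite matrix. -/
def corner (r : ℕ) (A : Matrix ℕ ℕ R⟦X⟧) : Matrix (Fin r) (Fin r) R⟦X⟧ :=
  A.submatrix Fin.val Fin.val

theorem coeff_charpolyRev_corner (A : Matrix ℕ ℕ R⟦X⟧) (r n : ℕ) :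
    (corner r A).charpolyRev.coeff n =
      (-1) ^ n * ∑ S ∈ (Finset.range r).powersetCard n, principalMinor A S := by
  have h : Finset.range r = Finset.univ.map (Fin.valEmbedding (n := r)) := by
    ext x; simp
  rw [coeff_charpolyRev_eq_sum_minors, h, Finset.powersetCard_map, Finset.sum_map]
  congr 1
  refine Finset.sum_congr rfl fun s _ => ?_
  let e : s → (s.map Fin.valEmbedding : Finset ℕ) :=
    fun x => ⟨x.1, Finset.mem_map_of_mem Fin.valEmbedding x.2⟩
  have he : Function.Bijective e := by
    refine ⟨fun x y hxy => Subtype.ext (Fin.ext (congrArg Subtype.val hxy)), ?_⟩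
    rintro ⟨y, hy⟩
    obtain ⟨x, hx, rfl⟩ := Finset.mem_map.1 hy
    exact ⟨⟨x, hx⟩, rfl⟩
  exact Matrix.det_submatrix_equiv_self (Equiv.ofBijective e he)
    (A.submatrix (Subtype.val : ↥(s.map Fin.valEmbedding) → ℕ) Subtype.val)

/-- Modulo T^N only index sets inside {0, …, dN} contribute, so the finite theory applies to a
corner of size dN + 1. -/
theorem Decays.X_pow_dvd_fredholmDet_sub (hA : Decays d A) (N n : ℕ) :
    X ^ N ∣ coeff n (fredholmDet A) - (corner (d * N + 1) A).charpolyRev.coeff n := by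
  rw [X_pow_dvd_iff]
  intro m hm
  have h1 : ((-1) ^ n : R⟦X⟧) = C ((-1) ^ n) := by simp
  rw [map_sub, coeff_charpolyRev_corner, h1, coeff_C_mul, map_sum,
    hA.coeff_coeff_fredholmDet n (r := d * N + 1), sub_self]
  have := Nat.mul_le_mul_left d hm.le
  omega

/-- `B` is the sequence of powers of the row-finite matrix `A`. -/
structure IsPowers (b : ℕ → ℕ) (A : Matrix ℕ ℕ R⟦X⟧) (B : ℕ → Matrix ℕ ℕ R⟦X⟧) : Prop where
  one : B 1 = A
  succ : ∀ k u v, B (k + 1) u v = ∑ w ∈ Finset.range (b u), A u w * B k w v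
  row : ∀ u w, b u ≤ w → A u w = 0

variable {b : ℕ → ℕ} {B : ℕ → Matrix ℕ ℕ R⟦X⟧}

/-- Adding 2u ≤ di + w and 2w ≤ dj + v and dropping the surplus w keeps the same constant d for
every power. -/
theorem IsPowers.decays (hB : IsPowers b A B) (hA : Decays d A) (k : ℕ) : Decays d (B (k + 1)) := by
  induction k with
  | zero => rwa [zero_add, hB.one]
  | succ k ih =>
    intro u v m hm
    rw [hB.succ, map_sum] at hm
    obtain ⟨w, -, hw⟩ := Finset.exists_ne_zero_of_sum_ne_zero hm
    rw [coeff_mul] at hw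
    obtain ⟨⟨i, j⟩, hij, hne⟩ := Finset.exists_ne_zero_of_sum_ne_zero hw
    rw [Finset.HasAntidiagonal.mem_antidiagonal] at hij
    have h1 := hA _ _ _ (left_ne_zero_of_mul hne)
    have h2 := ih _ _ _ (right_ne_zero_of_mul hne)
    rw [← hij]
    simp only at h1 h2 ⊢
    rw [mul_add]
    omega

/-- A path from u to v leaving the corner at an index w ≥ r needs 2w ≤ dm + v with v < r, hence r <
dm, which is impossible for m < N. So truncation commutes with powers modulo T^N. -/
theorem IsPowers.X_pow_dvd_sub_corner_pow (hB : IsPowers b A B) (hA : Decays d A) {N r : ℕ}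
    (hr : r = d * N + 1) (k : ℕ) (u v : Fin r) :
    X ^ N ∣ B (k + 1) u v - (corner r A ^ (k + 1)) u v := by
  induction k generalizing u v with
  | zero => simp [hB.one, corner]
  | succ k ih =>
    -- Neither r nor the row bound `b u` need dominate the other, so the sum is first extended to
    -- their maximum.
    have h1 : B (k + 1 + 1) u v = ∑ w ∈ Finset.range (max r (b u)), A u w * B (k + 1) w v := by
      rw [hB.succ]
      refine Finset.sum_subset (Finset.range_subset_range.2 (le_max_right _ _)) fun w _ hw => ?_
      rw [hB.row u w (by simpa using hw), zero_mul]
    have h2 : X ^ N ∣ B (k + 1 + 1) u v - ∑ w ∈ Finset.range r, A u w * B (k + 1) w v := by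
      rw [h1, ← Finset.sum_sdiff (Finset.range_subset_range.2 (le_max_left r (b u))),
        add_sub_cancel_right]
      refine Finset.dvd_sum fun w hw => Dvd.dvd.mul_left ?_ _
      rw [X_pow_dvd_iff]
      intro m hm
      by_contra h0
      have h3 := hB.decays hA k _ _ _ h0
      have h4 : r ≤ w := by simpa using (Finset.mem_sdiff.1 hw).2
      have h5 := v.2
      have := Nat.mul_le_mul_left d hm.le
      omega
    have h3 : X ^ N ∣ ∑ w ∈ Finset.range r, A u w * B (k + 1) w v -
        (corner r A ^ (k + 1 + 1)) u v := by
      rw [pow_succ' _ (k + 1), Matrix.mul_apply, Finset.sum_range, ← Finset.sum_sub_distrib]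
      refine Finset.dvd_sum fun w _ => ?_
      rw [show corner r A u w = A u w from rfl, ← mul_sub]
      exact (ih w v).mul_left _
    simpa using h2.add h3

/-- Newton's identities for the Fredholm determinant of a decaying matrix. -/
theorem IsPowers.newton (hB : IsPowers b A B) (hA : Decays d A) {t : ℕ → R⟦X⟧}
    (ht : ∀ k m r, d * m < r →
      coeff m (t (k + 1)) = ∑ u ∈ Finset.range r, coeff m (B (k + 1) u u)) (n : ℕ) :
    ((n : R⟦X⟧) + 1) * coeff (n + 1) (fredholmDet A) =
      -∑ i ∈ Finset.range (n + 1), t (i + 1) * coeff (n - i) (fredholmDet A) := by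
  have key : ∀ N, X ^ N ∣ ((n : R⟦X⟧) + 1) * coeff (n + 1) (fredholmDet A) -
      -∑ i ∈ Finset.range (n + 1), t (i + 1) * coeff (n - i) (fredholmDet A) := by
    intro N
    have htr : ∀ k, X ^ N ∣ t (k + 1) - (corner (d * N + 1) A ^ (k + 1)).trace := by
      intro k
      have h1 : X ^ N ∣ t (k + 1) - ∑ u ∈ Finset.range (d * N + 1), B (k + 1) u u := by
        rw [X_pow_dvd_iff]
        intro m hm
        rw [map_sub, map_sum, ht k m (d * N + 1), sub_self]
        have := Nat.mul_le_mul_left d hm.le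
        omega
      have h2 : X ^ N ∣ ∑ u ∈ Finset.range (d * N + 1), B (k + 1) u u -
          (corner (d * N + 1) A ^ (k + 1)).trace := by
        rw [Finset.sum_range, Matrix.trace, ← Finset.sum_sub_distrib]
        exact Finset.dvd_sum fun u _ => hB.X_pow_dvd_sub_corner_pow hA rfl k u u
      simpa using h1.add h2
    have hn := newton_charpolyRev (corner (d * N + 1) A) n
    have hD := hA.X_pow_dvd_fredholmDet_sub N
    -- In the quotient by T^N the determinant and the traces become those of the corner, where the
    -- finite identity holds.
    simp only [← Ideal.mem_span_singleton, ← Ideal.Quotient.mk_eq_mk_iff_sub_mem] at hD htr ⊢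
    simp only [map_mul, map_neg, map_sum, hD, htr]
    rw [← map_mul, hn]
    simp only [map_mul, map_neg, map_sum]
  rw [← sub_eq_zero]
  ext m
  exact X_pow_dvd_iff.1 (key (m + 1)) m (Nat.lt_succ_self m)

end Fredholm

/-! ### Convergence and separation in adically complete rings -/

section AdicSeries

theorem exists_forall_pow_dvd_sub_sum {R : Type*} [CommRing R] (ϖ : R)
    [IsPrecomplete (Ideal.span {ϖ}) R] (v : ℕ → R) :
    ∃ w : R, ∀ n, ϖ ^ n ∣ w - ∑ i ∈ Finset.range n, ϖ ^ i * v i := by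
  obtain ⟨w, hw⟩ := IsPrecomplete.prec (I := Ideal.span {ϖ}) (M := R) inferInstance
    (f := fun n => ∑ i ∈ Finset.range n, ϖ ^ i * v i) (by
      intro m n hmn
      rw [SModEq.sub_mem, smul_eq_mul, Ideal.mul_top, Ideal.span_singleton_pow,
        Ideal.mem_span_singleton, ← neg_sub, dvd_neg, ← Finset.sum_sdiff
          (Finset.range_subset_range.2 hmn), add_sub_cancel_right]
      refine Finset.dvd_sum fun i hi => Dvd.dvd.mul_right (pow_dvd_pow _ ?_) _
      simpa using (Finset.mem_sdiff.1 hi).2)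
  refine ⟨w, fun n => ?_⟩
  have := hw n
  rwa [SModEq.sub_mem, smul_eq_mul, Ideal.mul_top, Ideal.span_singleton_pow,
    Ideal.mem_span_singleton, ← neg_sub, dvd_neg] at this

theorem eq_zero_of_forall_pow_dvd {R : Type*} [CommRing R] {ϖ : R}
    [IsHausdorff (Ideal.span {ϖ}) R] {w : R} (h : ∀ n, ϖ ^ n ∣ w) : w = 0 := by
  refine IsHausdorff.haus (I := Ideal.span {ϖ}) (M := R) inferInstance w fun n => ?_
  rw [SModEq.zero, smul_eq_mul, Ideal.mul_top, Ideal.span_singleton_pow,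
    Ideal.mem_span_singleton]
  exact h n

end AdicSeries

/-! ### Witt vectors over ℤ_p and their Frobenius -/

section Witt

theorem teichmuller_injective (p : ℕ) [Fact p.Prime] {L : Type*} [CommRing L] :
    Function.Injective (WittVector.teichmuller p : L → WittVector p L) :=
  fun a b h => by simpa using congrArg (fun w => WittVector.coeff w 0) h

variable (p : ℕ) [Fact p.Prime] {L : Type*} [Field L] [CharP L p]

theorem padicIntToWitt_injective :
    Function.Injective (padicIntToWitt p : ℤ_[p] →+* WittVector p L) :=
  (WittVector.map_injective _ (ZMod.castHom (dvd_refl p) L).injective).comp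
    (WittVector.equiv p).symm.injective

theorem frobenius_padicIntToWitt (z : ℤ_[p]) :
    WittVector.frobenius (padicIntToWitt p z : WittVector p L) = padicIntToWitt p z := by
  ext n
  rw [WittVector.coeff_frobenius_charP]
  simp only [padicIntToWitt, RingHom.comp_apply, WittVector.map_coeff, ← map_pow, ZMod.pow_card]

theorem map_padicIntToWitt {K : Type*} [Field K] [CharP K p] (g : K →+* L) (z : ℤ_[p]) :
    WittVector.map g (padicIntToWitt p z) = padicIntToWitt p z := by
  ext n
  simp only [padicIntToWitt, RingHom.comp_apply, WittVector.map_coeff]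
  exact RingHom.congr_fun (Subsingleton.elim (g.comp (ZMod.castHom (dvd_refl p) K)) _) _

/-- Only valuations matter: if n had the larger one, cancelling a power of p would make p divide 1
in W(L), which is false modulo p. This descent carries the integrality of C_f from W(K) to ℤ_p. -/
theorem natCast_dvd_of_dvd_padicIntToWitt {n : ℕ} (hn : n ≠ 0) {z : ℤ_[p]}
    (h : (n : WittVector p L) ∣ padicIntToWitt p z) : (n : ℤ_[p]) ∣ z := by
  rcases eq_or_ne z 0 with rfl | hz
  · exact dvd_zero _
  have hn0 : (n : ℤ_[p]) ≠ 0 := by exact_mod_cast hn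
  have e1 := PadicInt.unitCoeff_spec hz
  have e2 := PadicInt.unitCoeff_spec hn0
  set b := (n : ℤ_[p]).valuation
  set a := z.valuation
  rcases le_or_gt b a with hab | hab
  · rw [e1, e2, Units.mul_left_dvd]
    exact (pow_dvd_pow _ hab).mul_left _
  · exfalso
    rw [← map_natCast (padicIntToWitt p : ℤ_[p] →+* WittVector p L), e1, e2, map_mul, map_mul,
      map_pow, map_pow, map_natCast] at h
    have hu : ∀ u : ℤ_[p]ˣ, IsUnit (padicIntToWitt p (u : ℤ_[p]) : WittVector p L) :=
      fun u => u.isUnit.map _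
    rw [(hu _).mul_left_dvd, (hu _).dvd_mul_left] at h
    have hp0 : (p : WittVector p L) ^ a ≠ 0 := by
      apply pow_ne_zero
      rw [← map_natCast (padicIntToWitt p : ℤ_[p] →+* WittVector p L)]
      exact (map_ne_zero_iff _ (padicIntToWitt_injective p)).2
        (by exact_mod_cast (Fact.out : p.Prime).ne_zero)
    have h1 : (p : WittVector p L) ∣ 1 := by
      rw [← mul_dvd_mul_iff_left hp0, mul_one, ← pow_succ]
      exact (pow_dvd_pow _ hab).trans h
    have h2 := map_dvd (WittVector.constantCoeff : WittVector p L →+* L) h1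
    rw [map_natCast, CharP.cast_eq_zero, map_one] at h2
    exact zero_ne_one (zero_dvd_iff.1 h2).symm

theorem frobenius_iterate_teichmuller (j : ℕ) (t : L) :
    WittVector.frobenius^[j] (WittVector.teichmuller p t) =
      WittVector.teichmuller p t ^ p ^ j := by
  induction j with
  | zero => simp
  | succ j ih =>
    rw [Function.iterate_succ_apply', ih, map_pow, pow_succ', pow_mul,
      WittVector.frobenius_eq_map_frobenius, WittVector.map_teichmuller, frobenius_def, map_pow]

/-- The `j`-th power of the Frobenius of the ring of Witt vectors. -/
noncomputable def frobPow (L : Type*) [Field L] [CharP L p] (j : ℕ) :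
    WittVector p L →+* WittVector p L :=
  (WittVector.frobenius : WittVector p L →+* WittVector p L) ^ j

theorem frobPow_apply (j : ℕ) (w : WittVector p L) :
    frobPow p L j w = WittVector.frobenius^[j] w := by
  rw [frobPow, RingHom.coe_pow]

theorem frobPow_padicIntToWitt (j : ℕ) (z : ℤ_[p]) :
    frobPow p L j (padicIntToWitt p z) = padicIntToWitt p z := by
  rw [frobPow_apply]
  exact Function.iterate_fixed (frobenius_padicIntToWitt p z) j

theorem frobPow_teichmuller (j : ℕ) (t : L) :
    frobPow p L j (WittVector.teichmuller p t) = WittVector.teichmuller p t ^ p ^ j := by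
  rw [frobPow_apply, frobenius_iterate_teichmuller]

end Witt

/-! ### The trace of W(L) and sums over Teichmüller points -/

section Trace

variable (p : ℕ) [Fact p.Prime] {L : Type*} [Field L] [Finite L] [CharP L p]

theorem exists_eq_sum_add_p_mul {ι : Type*} [Fintype ι] [Algebra (ZMod p) L]
    (b : Module.Basis ι (ZMod p) L) (w : WittVector p L) :
    ∃ (c : ι → ℤ_[p]) (w' : WittVector p L),
      w = ∑ i, padicIntToWitt p (c i) * WittVector.teichmuller p (b i) + p * w' := by
  refine ⟨fun i => ((b.repr (w.coeff 0) i).val : ℤ_[p]), ?_⟩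
  suffices h : w - ∑ i, padicIntToWitt p ((b.repr (w.coeff 0) i).val : ℤ_[p]) *
      WittVector.teichmuller p (b i) ∈ Ideal.span {(p : WittVector p L)} by
    obtain ⟨w', hw'⟩ := Ideal.mem_span_singleton.1 h
    exact ⟨w', by rw [← hw', add_sub_cancel]⟩
  rw [← WittVector.ker_constantCoeff, RingHom.mem_ker, map_sub, map_sum, sub_eq_zero]
  nth_rewrite 1 [WittVector.constantCoeff_apply, ← b.sum_repr (w.coeff 0)]
  refine Finset.sum_congr rfl fun i _ => ?_
  rw [map_mul, map_natCast, map_natCast, WittVector.constantCoeff_apply,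
    WittVector.teichmuller_coeff_zero, Algebra.smul_def]
  congr 1
  rw [← map_natCast (algebraMap (ZMod p) L), ZMod.natCast_zmod_val]

/-- Successive approximation modulo p: each remainder is expanded again, and the digits of one
coordinate assemble to an element of ℤ_p by completeness. -/
theorem exists_eq_sum_teichmuller {ι : Type*} [Fintype ι] [Algebra (ZMod p) L]
    (b : Module.Basis ι (ZMod p) L) (w : WittVector p L) :
    ∃ c : ι → ℤ_[p], w = ∑ i, padicIntToWitt p (c i) * WittVector.teichmuller p (b i) := by
  choose c g hg using exists_eq_sum_add_p_mul p b
  have : IsPrecomplete (Ideal.span {(p : ℤ_[p])}) ℤ_[p] := by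
    rw [← PadicInt.maximalIdeal_eq_span_p]; infer_instance
  choose z hz using fun i => exists_forall_pow_dvd_sub_sum (p : ℤ_[p]) fun k => c (g^[k] w) i
  have hsum : ∀ n, w = ∑ k ∈ Finset.range n, (p : WittVector p L) ^ k *
      ∑ i, padicIntToWitt p (c (g^[k] w) i) * WittVector.teichmuller p (b i) +
        (p : WittVector p L) ^ n * g^[n] w := by
    intro n
    induction n with
    | zero => simp
    | succ n ih =>
      nth_rewrite 1 [ih, hg (g^[n] w)]
      rw [Finset.sum_range_succ, Function.iterate_succ_apply', pow_succ]
      ring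
  refine ⟨z, ?_⟩
  rw [← sub_eq_zero]
  refine eq_zero_of_forall_pow_dvd (ϖ := (p : WittVector p L)) fun n => ?_
  rw [← sub_sub_sub_cancel_right _ _ (∑ k ∈ Finset.range n, (p : WittVector p L) ^ k *
      ∑ i, padicIntToWitt p (c (g^[k] w) i) * WittVector.teichmuller p (b i))]
  refine dvd_sub ?_ ?_
  · nth_rewrite 1 [hsum n]
    rw [add_sub_cancel_left]
    exact dvd_mul_right _ _
  · simp only [Finset.mul_sum]
    rw [Finset.sum_comm, ← Finset.sum_sub_distrib]
    refine Finset.dvd_sum fun i _ => ?_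
    have h := (map_dvd (padicIntToWitt p : ℤ_[p] →+* WittVector p L) (hz i n)).mul_right
      (WittVector.teichmuller p (b i))
    simpa [sub_mul, Finset.sum_mul, mul_assoc] using h

/-- If σ^i = σ^j with i < j < r, evaluation at Teichmüller points makes the exponent of the group of
units divide p^j - p^i, too small to be a multiple of p^r - 1. Distinctness is the hypothesis of
Dedekind's independence of characters. -/
theorem frobPow_injOn {r : ℕ} (hr : Nat.card L = p ^ r) :
    Function.Injective fun j : Fin r => ((frobPow p L j : WittVector p L →+* WittVector p L) :
      WittVector p L →* WittVector p L) := by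
  have hp := (Fact.out : p.Prime)
  have key : ∀ i j : ℕ, i < j → j < r → frobPow p L i ≠ frobPow p L j := by
    intro i j hij hj h
    have : Fintype L := Fintype.ofFinite L
    have hlt : p ^ i < p ^ j := Nat.pow_lt_pow_right hp.one_lt hij
    have h1 : ∀ t : Lˣ, t ^ (p ^ j - p ^ i) = 1 := by
      intro t
      have h2 := RingHom.congr_fun h (WittVector.teichmuller p (t : L))
      rw [frobPow_teichmuller, frobPow_teichmuller, ← map_pow, ← map_pow] at h2
      have h3 : t ^ p ^ i = t ^ p ^ j := Units.ext (by simpa using teichmuller_injective p h2)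
      rw [pow_sub _ hlt.le, ← h3, mul_inv_cancel]
    rw [FiniteField.forall_pow_eq_one_iff, ← Nat.card_eq_fintype_card, hr] at h1
    have h4 := Nat.le_of_dvd (by omega) h1
    have h5 : p ^ j < p ^ r := Nat.pow_lt_pow_right hp.one_lt hj
    have h6 : 1 ≤ p ^ i := Nat.one_le_pow _ _ hp.pos
    have h7 : p ^ j * 2 ≤ p ^ r := by
      calc p ^ j * 2 ≤ p ^ j * p := Nat.mul_le_mul_left _ hp.two_le
        _ = p ^ (j + 1) := (pow_succ _ _).symm
        _ ≤ p ^ r := Nat.pow_le_pow_right hp.pos hj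
    omega
  intro i j h
  have h' : frobPow p L i = frobPow p L j := RingHom.ext fun w => DFunLike.congr_fun h w
  rcases lt_trichotomy i j with hij | hij | hij
  · exact (key i j hij j.2 h').elim
  · exact hij
  · exact (key j i hij i.2 h'.symm).elim

/-- The trace of `W(L)` over `ℤ_p` is the sum of the powers of the Frobenius. -/
theorem padicIntToWitt_wittTrace {r : ℕ} (hr : Nat.card L = p ^ r) (y : WittVector p L) :
    padicIntToWitt p (wittTrace p y) = ∑ j ∈ Finset.range r, frobPow p L j y := by
  have hp := (Fact.out : p.Prime)
  let _ : Algebra (ZMod p) L := ZMod.algebra L p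
  let _ : Algebra ℤ_[p] (WittVector p L) := (padicIntToWitt p).toAlgebra
  have hfr : Module.finrank (ZMod p) L = r := by
    have h := FiniteField.pow_finrank_eq_natCard p L
    rw [hr] at h
    exact Nat.pow_right_injective hp.two_le h
  let b := Module.finBasisOfFinrankEq (ZMod p) L hfr
  let e : Fin r → WittVector p L := fun i => WittVector.teichmuller p (b i)
  have hsmul : ∀ (z : ℤ_[p]) (w : WittVector p L), z • w = padicIntToWitt p z * w := fun _ _ => rfl
  let F : Matrix (Fin r) (Fin r) (WittVector p L) := Matrix.of fun j i => frobPow p L j (e i)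
  -- A relation between the rows is a relation between the σ^j on the generators e_i, hence on all
  -- of W(L), contradicting Dedekind independence.
  have hF : F.det ≠ 0 := by
    rw [Ne, ← Matrix.exists_vecMul_eq_zero_iff]
    rintro ⟨v, hv0, hv⟩
    apply hv0
    have hli := (linearIndependent_monoidHom (WittVector p L) (WittVector p L)).comp _
      (frobPow_injOn p hr)
    refine funext (Fintype.linearIndependent_iff.1 hli v ?_)
    funext w
    obtain ⟨c, hc⟩ := exists_eq_sum_teichmuller p b w
    simp only [Finset.sum_apply, Pi.smul_apply, Function.comp_apply, Pi.zero_apply, smul_eq_mul]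
    have h1 : ∀ j : Fin r, v j * frobPow p L j w =
        ∑ i, padicIntToWitt p (c i) * (v j * F j i) := by
      intro j
      nth_rewrite 1 [hc]
      rw [map_sum, Finset.mul_sum]
      refine Finset.sum_congr rfl fun i _ => ?_
      rw [map_mul, frobPow_padicIntToWitt]
      simp only [F, e, Matrix.of_apply]
      ring
    refine (Finset.sum_congr rfl fun j _ => h1 j).trans ?_
    rw [Finset.sum_comm]
    refine Finset.sum_eq_zero fun i _ => ?_
    rw [← Finset.mul_sum, show ∑ j, v j * F j i = Matrix.vecMul v F i from rfl, hv]
    simp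
  have hind : LinearIndependent ℤ_[p] e := by
    rw [Fintype.linearIndependent_iff]
    intro c hc i
    have h1 : F.mulVec (fun i => padicIntToWitt p (c i)) = 0 := by
      funext j
      have h2 := congrArg (frobPow p L j) hc
      rw [map_sum, map_zero] at h2
      rw [Pi.zero_apply, ← h2]
      change ∑ i, F j i * padicIntToWitt p (c i) = _
      refine Finset.sum_congr rfl fun i _ => ?_
      rw [hsmul, map_mul, frobPow_padicIntToWitt, mul_comm]
      rfl
    have h3 := congrFun (Matrix.eq_zero_of_mulVec_eq_zero hF h1) i
    exact (map_eq_zero_iff _ (padicIntToWitt_injective p)).1 h3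
  have hspan : ⊤ ≤ Submodule.span ℤ_[p] (Set.range e) := by
    intro w _
    obtain ⟨c, hc⟩ := exists_eq_sum_teichmuller p b w
    rw [hc]
    exact Submodule.sum_mem _ fun i _ =>
      Submodule.smul_mem _ (c i) (Submodule.subset_span ⟨i, rfl⟩)
  let B := Module.Basis.mk hind hspan
  have hB : ∀ i, B i = e i := fun i => Module.Basis.mk_apply hind hspan i
  let Y := (Algebra.leftMulMatrix B y).map (padicIntToWitt p : ℤ_[p] →+* WittVector p L)
  -- F diagonalizes multiplication by y: this is σ^j applied to the expansion of y e_i in the basis.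
  have hY : Matrix.diagonal (fun j : Fin r => frobPow p L j y) * F = F * Y := by
    refine Matrix.ext fun j i => ?_
    rw [Matrix.diagonal_mul, Matrix.mul_apply]
    have h1 : y * e i = ∑ k, Algebra.leftMulMatrix B y k i • e k := by
      simp only [Algebra.leftMulMatrix_eq_repr_mul, ← hB, B.sum_repr]
    have h2 := congrArg (frobPow p L j) h1
    rw [map_mul, map_sum] at h2
    refine h2.trans (Finset.sum_congr rfl fun k _ => ?_)
    rw [hsmul, map_mul, frobPow_padicIntToWitt, mul_comm]
    rfl
  -- The adjugate stands in for the inverse of F; only `F.det ≠ 0` in a domain is needed.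
  have htr : F.det * Y.trace = F.det * ∑ j : Fin r, frobPow p L j y := by
    have h1 := congrArg (fun Z => (F.adjugate * Z).trace) hY
    rw [← mul_assoc, Matrix.trace_mul_comm, ← mul_assoc, ← mul_assoc, Matrix.mul_adjugate,
      Matrix.adjugate_mul, Matrix.smul_mul, Matrix.smul_mul, one_mul, one_mul, Matrix.trace_smul,
      Matrix.trace_smul, Matrix.trace_diagonal] at h1
    exact h1.symm
  have hT : padicIntToWitt p (wittTrace p y) = Y.trace := by
    have h1 : wittTrace p y = (Algebra.leftMulMatrix B y).trace :=
      Algebra.trace_eq_matrix_trace B y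
    rw [h1, Matrix.trace, map_sum]
    rfl
  rw [hT, mul_left_cancel₀ hF htr, Finset.sum_range]

theorem frobPow_eq_id {r : ℕ} (hr : Nat.card L = p ^ r) : frobPow p L r = RingHom.id _ := by
  have : Fintype L := Fintype.ofFinite L
  have h : ∀ (j : ℕ) (w : WittVector p L) (n : ℕ),
      (WittVector.frobenius^[j] w).coeff n = w.coeff n ^ p ^ j := by
    intro j w n
    induction j with
    | zero => simp
    | succ j ih =>
      rw [Function.iterate_succ_apply', WittVector.coeff_frobenius_charP, ih, ← pow_mul, pow_succ]
  ext w n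
  rw [frobPow_apply, h, ← hr, Nat.card_eq_fintype_card, FiniteField.pow_card, RingHom.id_apply]

/-- The roots of unity of order prime to `p` are the Teichmüller representatives. -/
theorem sum_nthRootsFinset {M : Type*} [AddCommMonoid M] [Fintype Lˣ] (g : WittVector p L → M) :
    ∑ x ∈ Polynomial.nthRootsFinset (Nat.card L - 1) (1 : WittVector p L), g x =
      ∑ t : Lˣ, g (WittVector.teichmuller p (t : L)) := by
  classical
  have : Fintype L := Fintype.ofFinite L
  have hinj : Function.Injective fun t : Lˣ => WittVector.teichmuller p (t : L) :=
    (teichmuller_injective p).comp Units.val_injective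
  have hcard : Fintype.card Lˣ = Nat.card L - 1 := by
    rw [← Nat.card_eq_fintype_card, Nat.card_units]
  have hpos : 0 < Nat.card L - 1 := hcard ▸ Fintype.card_pos
  have h : Finset.univ.image (fun t : Lˣ => WittVector.teichmuller p (t : L)) =
      Polynomial.nthRootsFinset (Nat.card L - 1) (1 : WittVector p L) := by
    -- The lifts already supply |L| - 1 roots, the maximum possible.
    refine Finset.eq_of_subset_of_card_le ?_ ?_
    · intro x hx
      obtain ⟨t, -, rfl⟩ := Finset.mem_image.1 hx
      rw [Polynomial.mem_nthRootsFinset hpos, ← map_pow, ← Units.val_pow_eq_pow_val, ← hcard,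
        pow_card_eq_one, Units.val_one, map_one]
    · rw [Finset.card_image_of_injective _ hinj, Finset.card_univ, hcard,
        Polynomial.nthRootsFinset_def]
      exact (Multiset.toFinset_card_le _).trans (Polynomial.card_nthRoots _ _)
  rw [← h, Finset.sum_image fun x _ y _ hxy => hinj hxy]

/-- Orthogonality: t ↦ t̂^n is a character of the cyclic group Lˣ, trivial exactly when the order
divides n. -/
theorem sum_teichmuller_pow [Fintype Lˣ] (n : ℕ) :
    ∑ t : Lˣ, (WittVector.teichmuller p (t : L)) ^ n =
      if Nat.card L - 1 ∣ n then ((Nat.card L - 1 : ℕ) : WittVector p L) else 0 := by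
  classical
  have : Fintype L := Fintype.ofFinite L
  let g : Lˣ →* WittVector p L :=
    (powMonoidHom n).comp ((WittVector.teichmuller p).comp (Units.coeHom L))
  have hg : ∀ t, g t = (WittVector.teichmuller p (t : L)) ^ n := fun _ => rfl
  have h1 : g = 1 ↔ Nat.card L - 1 ∣ n := by
    rw [Nat.card_eq_fintype_card, ← FiniteField.forall_pow_eq_one_iff, DFunLike.ext_iff]
    refine forall_congr' fun t => ?_
    rw [hg, ← map_pow, MonoidHom.one_apply, ← map_one (WittVector.teichmuller p),
      (teichmuller_injective p).eq_iff, ← Units.val_pow_eq_pow_val, Units.val_eq_one]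
  have h2 := sum_hom_units g
  simp only [hg, h1, ← Nat.card_eq_fintype_card, Nat.card_units] at h2
  rw [h2]
  split_ifs <;> simp

end Trace

/-! ### The values of f̂ at Teichmüller points -/

section FHat

variable (p : ℕ) [Fact p.Prime]

theorem wittTrace_add {L : Type*} [Field L] [CharP L p] (x y : WittVector p L) :
    wittTrace p (x + y) = wittTrace p x + wittTrace p y := by
  rw [wittTrace, wittTrace, wittTrace, map_add]

theorem wittTrace_p_pow_mul {L : Type*} [Field L] [CharP L p] (n : ℕ) (y : WittVector p L) :
    wittTrace p ((p : WittVector p L) ^ n * y) = (p : ℤ_[p]) ^ n * wittTrace p y := by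
  let _ : Algebra ℤ_[p] (WittVector p L) := (padicIntToWitt p).toAlgebra
  have h : (p : WittVector p L) ^ n * y = (p : ℤ_[p]) ^ n • y := by
    rw [Algebra.smul_def, map_pow, map_natCast]
  rw [h]
  exact map_smul (Algebra.trace ℤ_[p] (WittVector p L)) _ _

theorem t2Space_wittTopology {L : Type*} [Field L] [CharP L p] [PerfectRing L p] :
    @T2Space (WittVector p L) (wittTopology p L) := by
  let : TopologicalSpace (WittVector p L) := wittTopology p L
  have := (Ideal.span {(p : WittVector p L)}).nonarchimedean
  exact (IsAdic.isHausdorff_iff rfl).1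
    (inferInstance : IsHausdorff (Ideal.span {(p : WittVector p L)}) (WittVector p L))

theorem hasSum_wittTopology {L : Type*} [Field L] {v : ℕ → WittVector p L}
    {w : WittVector p L}
    (h : ∀ n, (p : WittVector p L) ^ n ∣ w - ∑ i ∈ Finset.range n, (p : WittVector p L) ^ i * v i) :
    letI : TopologicalSpace (WittVector p L) := wittTopology p L
    HasSum (fun i => (p : WittVector p L) ^ i * v i) w := by
  let : TopologicalSpace (WittVector p L) := wittTopology p L
  refine ((Ideal.span {(p : WittVector p L)}).hasBasis_nhds_adic w).tendsto_right_iff.2 fun N _ => ?_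
  refine Filter.eventually_atTop.2 ⟨Finset.range N, fun s hs => ?_⟩
  refine ⟨∑ i ∈ s, (p : WittVector p L) ^ i * v i - w, ?_, by simp⟩
  rw [Ideal.span_singleton_pow, SetLike.mem_coe, Ideal.mem_span_singleton,
    ← Finset.sum_sdiff hs, add_sub_assoc]
  refine dvd_add (Finset.dvd_sum fun i hi => Dvd.dvd.mul_right (pow_dvd_pow _ ?_) _) ?_
  · simpa using (Finset.mem_sdiff.1 hi).2
  · rw [← neg_sub, dvd_neg]
    exact h N

/-- Replaces the topological sum defining f̂(x) by congruences modulo p^n, the form in which it is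
used. -/
theorem p_pow_dvd_fHat_sub {K L : Type*} [Field K] [CharP K p] [Field L] [CharP L p]
    [PerfectRing L p] [Algebra K L] (f : ℕ → Polynomial K) (x : WittVector p L) (n : ℕ) :
    (p : WittVector p L) ^ n ∣ fHat p f x - ∑ i ∈ Finset.range n, (p : WittVector p L) ^ i *
      (teichPoly p (f i)).eval₂ (WittVector.map (algebraMap K L)) x := by
  let : TopologicalSpace (WittVector p L) := wittTopology p L
  have := t2Space_wittTopology p (L := L)
  obtain ⟨w, hw⟩ := exists_forall_pow_dvd_sub_sum (p : WittVector p L) fun i =>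
    (teichPoly p (f i)).eval₂ (WittVector.map (algebraMap K L)) x
  have h : fHat p f x = w := (hasSum_wittTopology p hw).tsum_eq
  rw [h]
  exact hw n

theorem teichPoly_eval₂ {K L : Type*} [Field K] [CharP K p] [Field L] [CharP L p]
    [Algebra K L] (h : Polynomial K) (t : L) :
    (teichPoly p h).eval₂ (WittVector.map (algebraMap K L)) (WittVector.teichmuller p t) =
      ∑ u ∈ Finset.range (h.natDegree + 1),
        WittVector.teichmuller p (algebraMap K L (h.coeff u) * t ^ u) := by
  rw [teichPoly, Polynomial.sum_over_range, Polynomial.eval₂_finsetSum]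
  · refine Finset.sum_congr rfl fun u _ => ?_
    rw [Polynomial.eval₂_monomial, WittVector.map_teichmuller, map_mul, map_pow]
  · simp

end FHat

/-! ### The differential equation of (1 + X)^w -/

section LogDerivative

theorem derivation_prod_of_eq_mul {R A ι : Type*} [CommRing R] [CommRing A] [Algebra R A]
    (δ : Derivation R A A) (s : Finset ι) (f g : ι → A) (h : ∀ i ∈ s, δ (f i) = g i * f i) :
    δ (∏ i ∈ s, f i) = (∑ i ∈ s, g i) * ∏ i ∈ s, f i := by
  classical
  rw [derivation_prod, Finset.sum_mul]
  refine Finset.sum_congr rfl fun i hi => ?_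
  rw [h i hi, ← Finset.mul_prod_erase s f hi]
  ring

variable {A : Type*} [CommRing A]

theorem derivative_map {B : Type*} [CommRing B] (φ : A →+* B) (F : A⟦X⟧) :
    derivative B (PowerSeries.map φ F) = PowerSeries.map φ (derivative A F) := by
  ext n
  simp [coeff_derivative]

/-- The differential equation `(1 + X) F' = w F` determines `F` up to its constant coefficient. -/
theorem eq_of_one_add_X_mul_derivative [IsDomain A] [CharZero A] {w : A} {F G : A⟦X⟧}
    (hF : (1 + X) * derivative A F = C w * F) (hG : (1 + X) * derivative A G = C w * G)
    (h0 : constantCoeff F = constantCoeff G) : F = G := by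
  have key : ∀ H : A⟦X⟧, (1 + X) * derivative A H = C w * H →
      ∀ n : ℕ, ((n : A) + 1) * coeff (n + 1) H = (w - n) * coeff n H := by
    intro H hH n
    have h := congrArg (coeff n) hH
    rw [add_mul, one_mul, map_add, coeff_derivative, coeff_C_mul] at h
    cases n with
    | zero => simp at h ⊢; linear_combination h
    | succ n =>
      rw [coeff_succ_X_mul, coeff_derivative] at h
      push_cast at h ⊢
      linear_combination h
  ext n
  induction n with
  | zero => simpa using h0
  | succ n ih =>
    refine mul_left_cancel₀ (Nat.cast_add_one_ne_zero n : (n : A) + 1 ≠ 0) ?_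
    rw [key F hF, key G hG, ih]

theorem one_add_X_mul_derivative_binomialSeries {R : Type*} [CommRing R] [BinomialRing R] (w : R) :
    (1 + X) * derivative R (binomialSeries R w) = C w * binomialSeries R w := by
  have key : ∀ n : ℕ, Ring.choose w (n + 1) * ((n : R) + 1) = (w - n) * Ring.choose w n := by
    intro n
    have h := Ring.choose_smul_choose w (Nat.le_succ n)
    rw [Nat.succ_eq_add_one, Nat.choose_succ_self_right, Nat.add_sub_cancel_left,
      Ring.choose_one_right, nsmul_eq_mul] at h
    push_cast at h
    linear_combination h
  ext n
  rw [add_mul, one_mul, map_add, coeff_derivative, coeff_C_mul]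
  simp only [binomialSeries_coeff, smul_eq_mul, mul_one, key]
  cases n with
  | zero => simp
  | succ n =>
    rw [coeff_succ_X_mul, coeff_derivative]
    simp only [binomialSeries_coeff, smul_eq_mul, mul_one, key]
    push_cast
    linear_combination -key n

end LogDerivative

/-! ### The logarithmic derivative ∑ X^{p^i - 1} -/

section LogDerivSeries

variable (p : ℕ)

/-- The series `∑_i X ^ (p ^ i - 1)`, the logarithmic derivative of the Artin-Hasse series. -/
noncomputable def ahLogDeriv (A : Type*) [CommRing A] : A⟦X⟧ :=
  open scoped Classical in
  PowerSeries.mk fun n => if ∃ i : ℕ, n + 1 = p ^ i then 1 else 0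

theorem map_ahLogDeriv {A B : Type*} [CommRing A] [CommRing B] (φ : A →+* B) :
    PowerSeries.map φ (ahLogDeriv p A) = ahLogDeriv p B := by
  ext n
  simp only [ahLogDeriv, coeff_map, coeff_mk]
  split_ifs <;> simp

variable {A : Type*} [CommRing A]

/-- The p-th power map permutes y, y^p, …, y^{p^{r-1}} cyclically. -/
theorem sum_pow_pow_add {y : A} {r : ℕ} (hy : y ^ p ^ r = y) (i : ℕ) :
    ∑ j ∈ Finset.range r, y ^ p ^ (j + i) = ∑ j ∈ Finset.range r, y ^ p ^ j := by
  induction i with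
  | zero => simp
  | succ i ih =>
    rw [← ih]
    have h1 := Finset.sum_range_succ (fun j => y ^ p ^ (j + i)) r
    rw [Finset.sum_range_succ'] at h1
    have h2 : y ^ p ^ (r + i) = y ^ p ^ (0 + i) := by
      rw [pow_add, pow_mul, hy, zero_add]
    rw [h2] at h1
    have h3 := add_right_cancel h1
    rw [← h3]
    refine Finset.sum_congr rfl fun j _ => ?_
    ring_nf

/-- The coefficient of X^{p^i - 1} on the left is ∑_j y^{p^{j+i}}, which does not depend on i. This
is where the exponents p^i of the Artin-Hasse series turn into a trace. -/
theorem sum_C_mul_rescale_ahLogDeriv {y : A} {r : ℕ} (hy : y ^ p ^ r = y) :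
    ∑ j ∈ Finset.range r, C (y ^ p ^ j) * rescale (y ^ p ^ j) (ahLogDeriv p A) =
      C (∑ j ∈ Finset.range r, y ^ p ^ j) * ahLogDeriv p A := by
  ext n
  simp only [map_sum (coeff n), coeff_C_mul, coeff_rescale, ahLogDeriv, coeff_mk]
  split_ifs with h
  · obtain ⟨i, hi⟩ := h
    rw [mul_one, ← sum_pow_pow_add p hy i]
    refine Finset.sum_congr rfl fun j _ => ?_
    rw [mul_one, ← pow_succ', ← pow_mul, hi, ← pow_add]
  · simp

theorem rescale_subst (c : A) (F : A⟦X⟧) {Y : A⟦X⟧} (hY : HasSubst Y) :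
    (rescale c F).subst Y = F.subst (C c * Y) := by
  rw [rescale_eq_subst, subst_comp_subst_apply (HasSubst.smul_X' c) hY]
  congr 1
  rw [smul_eq_C_mul, subst_mul hY, subst_X hY, subst_C]
  rfl

theorem subst_eq_C_add_mul (F : A⟦X⟧) {Y : A⟦X⟧} (hY : HasSubst Y) :
    F.subst Y = C (constantCoeff F) + Y * (PowerSeries.mk fun n => coeff (n + 1) F).subst Y := by
  nth_rewrite 1 [eq_X_mul_shift_add_const F]
  rw [subst_add hY, subst_mul hY, subst_X hY, subst_C, add_comm]
  rfl

end LogDerivSeries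

/-! ### The Artin-Hasse series along Frobenius orbits -/

section ArtinHasse

variable (p : ℕ) [Fact p.Prime]

theorem map_artinHasse :
    PowerSeries.map PadicInt.Coe.ringHom (artinHasse p) = artinHasseQ p := by
  ext n
  rw [coeff_map, artinHasse, coeff_mk]
  rfl

theorem derivative_artinHasse :
    derivative ℤ_[p] (artinHasse p) = ahLogDeriv p ℤ_[p] * artinHasse p := by
  have hinj : Function.Injective (PowerSeries.map (PadicInt.Coe.ringHom (p := p))) :=
    PowerSeries.map_injective _ Subtype.val_injective
  apply hinj
  rw [← derivative_map, map_mul, map_artinHasse, derivative_artinHasseQ, map_ahLogDeriv]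
  congr 1
  ext n
  rw [coeff_derivative, ahLog, ahLogDeriv, coeff_mk, coeff_mk]
  split_ifs
  · push_cast
    exact inv_mul_cancel₀ (Nat.cast_add_one_ne_zero n)
  · simp

theorem constantCoeff_artinHasse : constantCoeff (artinHasse p) = 1 := by
  rw [← coeff_zero_eq_constantCoeff_apply, artinHasse, coeff_mk]
  refine Subtype.ext ?_
  have := artinHasseQ_zero p
  rw [← coeff_zero_eq_constantCoeff_apply] at this
  exact this

theorem constantCoeff_one_add_X_pow_sub_one (n : ℕ) :
    constantCoeff ((1 + X) ^ n - 1 : ℤ_[p]⟦X⟧) = 0 := by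
  simp

theorem constantCoeff_piSeries (i : ℕ) : constantCoeff (piSeries p i) = 0 :=
  constantCoeff_subst_eq_zero (constantCoeff_one_add_X_pow_sub_one p _) _
    (constantCoeff_substInvOfIsUnit _ _)

theorem artinHasse_subst_piSeries (i : ℕ) :
    (artinHasse p).subst (piSeries p i) = (1 + X) ^ p ^ i := by
  have hY : HasSubst ((1 + X) ^ p ^ i - 1 : ℤ_[p]⟦X⟧) :=
    HasSubst.of_constantCoeff_zero' (constantCoeff_one_add_X_pow_sub_one p _)
  have hπ : HasSubst (piSeries p i) :=
    HasSubst.of_constantCoeff_zero' (constantCoeff_piSeries p i)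
  have h0 : constantCoeff (artinHasse p - 1) = 0 := by
    rw [map_sub, constantCoeff_artinHasse, map_one, sub_self]
  have h1 : (artinHasse p - 1).subst (piSeries p i) = ((1 + X) ^ p ^ i - 1 : ℤ_[p]⟦X⟧) := by
    rw [piSeries, ← subst_comp_subst_apply (HasSubst.substInvOfIsUnit _ _) hY,
      subst_substInvOfIsUnit_right _ h0, subst_X hY]
  have h2 : (1 : ℤ_[p]⟦X⟧).subst (piSeries p i) = (1 : ℤ_[p]⟦X⟧) := by
    rw [← coe_substAlgHom hπ, map_one]
  rw [subst_sub hπ, h2] at h1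
  simpa using h1

variable {A : Type*} [CommRing A] (φ : ℤ_[p] →+* A)

theorem derivative_artinHasse_subst {Y : A⟦X⟧} (hY : HasSubst Y) :
    derivative A ((PowerSeries.map φ (artinHasse p)).subst Y) =
      (ahLogDeriv p A).subst Y * derivative A Y * (PowerSeries.map φ (artinHasse p)).subst Y := by
  rw [derivative_subst hY, derivative_map, derivative_artinHasse, map_mul, map_ahLogDeriv,
    subst_mul hY]
  ring

theorem constantCoeff_map_artinHasse_subst {Y : A⟦X⟧} (hY : constantCoeff Y = 0) :
    constantCoeff ((PowerSeries.map φ (artinHasse p)).subst Y) = 1 := by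
  rw [subst_eq_C_add_mul _ (HasSubst.of_constantCoeff_zero' hY), map_add, map_mul, hY, zero_mul,
    add_zero, constantCoeff_C, ← coeff_zero_eq_constantCoeff_apply, coeff_map,
    coeff_zero_eq_constantCoeff_apply, constantCoeff_artinHasse, map_one]

/-- The product of `E(π y ^ (p ^ j))` over `j < r` is `(1 + X) ^ (n z)`, if `E(π) = (1 + X) ^ n`,
`y ^ (p ^ r) = y` and `z` is the sum of the `y ^ (p ^ j)`. -/
theorem prod_artinHasse_subst [IsDomain A] [CharZero A] {y : A} {r : ℕ} (hy : y ^ p ^ r = y)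
    {P : A⟦X⟧} (hP : constantCoeff P = 0) {n : ℕ}
    (hE : (PowerSeries.map φ (artinHasse p)).subst P = (1 + X) ^ n) {z : ℤ_[p]}
    (hz : φ z = ∑ j ∈ Finset.range r, y ^ p ^ j) :
    ∏ j ∈ Finset.range r, (PowerSeries.map φ (artinHasse p)).subst (C (y ^ p ^ j) * P) =
      PowerSeries.map φ (binomialSeries ℤ_[p] (n * z)) := by
  have hs := HasSubst.of_constantCoeff_zero' hP
  have hc : ∀ c : A, constantCoeff (C c * P) = 0 := fun c => by rw [map_mul, hP, mul_zero]
  -- The logarithmic derivative of E(P) = (1 + X)^n, cleared of its denominator.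
  have h1 : (1 + X) * ((ahLogDeriv p A).subst P * derivative A P) = (n : A⟦X⟧) := by
    have h2 := derivative_artinHasse_subst p φ hs
    rw [hE, derivative_pow] at h2
    have h3 : ((1 + X) ^ n : A⟦X⟧) ≠ 0 := by
      apply pow_ne_zero
      intro h
      simpa using congrArg (constantCoeff (R := A)) h
    refine mul_left_cancel₀ h3 ?_
    have h4 : derivative A (1 + X : A⟦X⟧) = 1 := by simp
    rw [h4] at h2
    cases n with
    | zero =>
      simp only [pow_zero, Nat.cast_zero, zero_mul, mul_one] at h2
      rw [← h2]
      simp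
    | succ n =>
      rw [Nat.add_sub_cancel] at h2
      linear_combination (-(1 + X)) * h2
  -- Both sides solve (1 + X) F' = w F with constant term 1; each of the r factors contributes n
  -- times a part of the sum z.
  refine eq_of_one_add_X_mul_derivative (w := φ (n * z)) ?_ ?_ ?_
  · rw [derivation_prod_of_eq_mul _ _ _ (fun j => C (y ^ p ^ j) *
      (rescale (y ^ p ^ j) (ahLogDeriv p A)).subst P * derivative A P)]
    · rw [← Finset.sum_mul, ← mul_assoc]
      congr 1
      have h5 : ∑ j ∈ Finset.range r, C (y ^ p ^ j) *
          (rescale (y ^ p ^ j) (ahLogDeriv p A)).subst P =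
          C (φ z) * (ahLogDeriv p A).subst P := by
        have h6 := congrArg (substAlgHom hs) (sum_C_mul_rescale_ahLogDeriv p hy)
        rw [map_sum, map_mul] at h6
        simp only [map_mul, coe_substAlgHom, subst_C] at h6
        rw [hz]
        exact h6
      rw [h5, map_mul, map_mul, map_natCast, map_natCast, ← h1]
      ring
    · intro j _
      rw [derivative_artinHasse_subst p φ (HasSubst.of_constantCoeff_zero' (hc _)),
        ← rescale_subst _ _ hs]
      congr 1
      rw [Derivation.leibniz, derivative_C]
      simp only [smul_eq_mul]
      ring
  · rw [derivative_map, ← map_X φ, ← map_one (PowerSeries.map φ), ← map_add, ← map_mul,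
      one_add_X_mul_derivative_binomialSeries, map_mul, map_C]
  · rw [map_prod, Finset.prod_eq_one fun j _ => constantCoeff_map_artinHasse_subst p φ (hc _)]
    rw [← coeff_zero_eq_constantCoeff_apply, coeff_map]
    simp

end ArtinHasse

/-! ### Congruences modulo p^N for the first N coefficients -/

section Congruence

variable (p : ℕ)

/-- The ideal of the power series whose first `N` coefficients are divisible by `p ^ N`. -/
def smallIdeal (N : ℕ) (A : Type*) [CommRing A] : Ideal A⟦X⟧ where
  carrier := {F | ∀ m < N, (p : A) ^ N ∣ coeff m F}
  add_mem' hF hG m hm := by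
    rw [map_add]
    exact dvd_add (hF m hm) (hG m hm)
  zero_mem' m _ := by simp
  smul_mem' F G hG m hm := by
    rw [smul_eq_mul, coeff_mul]
    refine Finset.dvd_sum fun x hx => (hG x.2 ?_).mul_left _
    have := Finset.HasAntidiagonal.mem_antidiagonal.1 hx
    omega

variable {A B : Type*} [CommRing A] [CommRing B]

variable {p}

theorem map_mem_smallIdeal (φ : A →+* B) {N : ℕ} {F : A⟦X⟧} (hF : F ∈ smallIdeal p N A) :
    PowerSeries.map φ F ∈ smallIdeal p N B := fun m hm => by
  have := map_dvd φ (hF m hm)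
  rwa [map_pow, map_natCast] at this

theorem subst_sub_C_mem_smallIdeal (F : A⟦X⟧) {Y : A⟦X⟧} (hY : HasSubst Y) {N : ℕ}
    (h : Y ∈ smallIdeal p N A) : F.subst Y - C (constantCoeff F) ∈ smallIdeal p N A := by
  rw [subst_eq_C_add_mul F hY, add_sub_cancel_left]
  exact Ideal.mul_mem_right _ _ h

theorem prod_sub_one_mem {ι : Type*} (I : Ideal A) (s : Finset ι) (f : ι → A)
    (h : ∀ i ∈ s, f i - 1 ∈ I) : ∏ i ∈ s, f i - 1 ∈ I := by
  rw [← Ideal.Quotient.mk_eq_mk_iff_sub_mem, map_prod, map_one]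
  refine Finset.prod_eq_one fun i hi => ?_
  rw [← map_one (Ideal.Quotient.mk I), Ideal.Quotient.mk_eq_mk_iff_sub_mem]
  exact h i hi

theorem prod_sub_prod_mem {ι : Type*} (I : Ideal A) (s : Finset ι) (f g : ι → A)
    (h : ∀ i ∈ s, f i - g i ∈ I) : ∏ i ∈ s, f i - ∏ i ∈ s, g i ∈ I := by
  rw [← Ideal.Quotient.mk_eq_mk_iff_sub_mem, map_prod, map_prod]
  exact Finset.prod_congr rfl fun i hi => (Ideal.Quotient.mk_eq_mk_iff_sub_mem _ _).2 (h i hi)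

variable (p) [Fact p.Prime]

/-- From m · C(w, m) = w · C(w - 1, m - 1): dividing by m costs at most p^m, by the crude bound
v_p(m) ≤ m. For m < N this explains the exponent N + N in what follows. -/
theorem p_pow_dvd_choose {N m : ℕ} (hm : m ≠ 0) {w : ℤ_[p]} (hw : (p : ℤ_[p]) ^ (N + m) ∣ w) :
    (p : ℤ_[p]) ^ N ∣ Ring.choose w m := by
  have hp := (Fact.out : p.Prime)
  have h1 := Ring.choose_smul_choose w (Nat.one_le_iff_ne_zero.2 hm)
  rw [Nat.choose_one_right, Ring.choose_one_right, nsmul_eq_mul] at h1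
  have h2 : (p : ℤ_[p]) ^ (N + m) ∣ (m : ℤ_[p]) * Ring.choose w m := h1 ▸ hw.mul_right _
  obtain ⟨v, m', hm', rfl⟩ := Nat.exists_eq_pow_mul_and_not_dvd hm p hp.ne_one
  have hv : v ≤ p ^ v * m' := (Nat.lt_pow_self hp.one_lt).le.trans
    (Nat.le_mul_of_pos_right _ (Nat.pos_of_ne_zero fun h => hm' (h ▸ dvd_zero p)))
  have h3 : (p : ℤ_[p]) ^ v * (p : ℤ_[p]) ^ N ∣
      (p : ℤ_[p]) ^ v * ((m' : ℤ_[p]) * Ring.choose w (p ^ v * m')) := by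
    rw [← pow_add, ← mul_assoc]
    refine (pow_dvd_pow _ (by omega)).trans (h2.trans (dvd_of_eq ?_))
    push_cast
    ring
  have hpv : (p : ℤ_[p]) ^ v ≠ 0 := pow_ne_zero _ (by exact_mod_cast hp.ne_zero)
  rw [mul_dvd_mul_iff_left hpv] at h3
  have hu : IsUnit (m' : ℤ_[p]) := by
    rw [PadicInt.isUnit_iff]
    by_contra hne
    refine hm' ?_
    have := (PadicInt.norm_intCast_lt_one_iff (p := p) (z := (m' : ℤ))).1
      (by simpa using lt_of_le_of_ne (PadicInt.norm_le_one _) hne)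
    exact_mod_cast this
  exact hu.dvd_mul_left.1 h3

theorem binomialSeries_sub_one_mem_smallIdeal {N : ℕ} {w : ℤ_[p]}
    (hw : (p : ℤ_[p]) ^ (N + N) ∣ w) : binomialSeries ℤ_[p] w - 1 ∈ smallIdeal p N ℤ_[p] := by
  intro m hm
  rw [map_sub, binomialSeries_coeff, smul_eq_mul, mul_one, coeff_one]
  rcases eq_or_ne m 0 with rfl | h0
  · simp
  · rw [if_neg h0, sub_zero]
    exact p_pow_dvd_choose p h0 ((pow_dvd_pow _ (by omega)).trans hw)

/-- (1 + X)^{p^i} - 1 is small because p^i is, and substitution into a series without constant term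
stays in the ideal. This makes the product over i converge. -/
theorem piSeries_mem_smallIdeal {N i : ℕ} (hi : N + N ≤ i) :
    piSeries p i ∈ smallIdeal p N ℤ_[p] := by
  have hY : HasSubst ((1 + X) ^ p ^ i - 1 : ℤ_[p]⟦X⟧) :=
    HasSubst.of_constantCoeff_zero' (constantCoeff_one_add_X_pow_sub_one p _)
  have h1 : ((1 + X) ^ p ^ i - 1 : ℤ_[p]⟦X⟧) ∈ smallIdeal p N ℤ_[p] := by
    have := binomialSeries_sub_one_mem_smallIdeal p (N := N) (w := ((p ^ i : ℕ) : ℤ_[p]))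
      (by push_cast; exact pow_dvd_pow _ hi)
    rwa [binomialSeries_nat] at this
  have h2 := subst_sub_C_mem_smallIdeal
    (substInvOfIsUnit (artinHasse p - 1) (isUnit_coeff_one_artinHasse p)) hY h1
  rwa [constantCoeff_substInvOfIsUnit, map_zero, sub_zero] at h2

end Congruence

/-! ### The ring W(K)[x]⟦T⟧ and degree bounds -/

section Swap

variable {R S : Type*} [CommRing R] [CommRing S]

/-- The embedding of `R[x]⟦T⟧` into `R⟦T⟧⟦x⟧`. -/
noncomputable def swap (R : Type*) [CommRing R] : (Polynomial R)⟦X⟧ →+* R⟦X⟧⟦X⟧ where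
  toFun F := PowerSeries.mk fun n => PowerSeries.mk fun m => (coeff m F).coeff n
  map_zero' := by ext; simp
  map_add' F G := by ext; simp
  map_one' := by
    ext n m
    rw [coeff_mk, coeff_mk, coeff_one, coeff_one]
    split_ifs with h1 h2 h2 <;> simp [h1, h2, coeff_one, Polynomial.coeff_one]
  map_mul' F G := by
    ext n m
    simp only [coeff_mk, coeff_mul, map_sum, Polynomial.finsetSum_coeff, Polynomial.coeff_mul]
    rw [Finset.sum_comm]

theorem coeff_coeff_swap (F : (Polynomial R)⟦X⟧) (n m : ℕ) :
    coeff m (coeff n (swap R F)) = (coeff m F).coeff n := by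
  change coeff m (coeff n (PowerSeries.mk fun n => PowerSeries.mk fun m => (coeff m F).coeff n)) = _
  rw [coeff_mk, coeff_mk]

theorem swap_C_monomial (u : ℕ) (c : R) :
    swap R (C (Polynomial.monomial u c)) = C (C c) * X ^ u := by
  ext n m
  rw [coeff_coeff_swap, coeff_C, coeff_C_mul, coeff_X_pow]
  split_ifs with h1 h2 h2
  · simp [h1, h2]
  · rw [Polynomial.coeff_monomial, if_neg (Ne.symm h2)]; simp
  · rw [mul_one, coeff_C, if_neg h1]; simp
  · simp

theorem swap_map_C (η : R⟦X⟧) : swap R (PowerSeries.map Polynomial.C η) = C η := by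
  ext n m
  rw [coeff_coeff_swap, coeff_map, Polynomial.coeff_C, coeff_C]
  split_ifs <;> simp

/-- The coefficient of `T ^ m` is a polynomial of degree at most `d m`, for all `m`. -/
def HasWeight (d : ℕ) (F : (Polynomial R)⟦X⟧) : Prop :=
  ∀ m, (coeff m F).natDegree ≤ d * m

theorem hasWeight_one (d : ℕ) : HasWeight d (1 : (Polynomial R)⟦X⟧) := fun m => by
  rw [coeff_one]
  split_ifs <;> simp

theorem HasWeight.mul {d : ℕ} {F G : (Polynomial R)⟦X⟧} (hF : HasWeight d F) (hG : HasWeight d G) :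
    HasWeight d (F * G) := fun m => by
  rw [coeff_mul]
  refine Polynomial.natDegree_sum_le_of_forall_le _ _ fun x hx => ?_
  refine Polynomial.natDegree_mul_le.trans ?_
  rw [← Finset.HasAntidiagonal.mem_antidiagonal.1 hx, mul_add]
  exact add_le_add (hF _) (hG _)

theorem hasWeight_prod {ι : Type*} {d : ℕ} (s : Finset ι) (F : ι → (Polynomial R)⟦X⟧)
    (h : ∀ i ∈ s, HasWeight d (F i)) : HasWeight d (∏ i ∈ s, F i) := by
  classical
  induction s using Finset.induction_on with
  | empty => simpa using hasWeight_one d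
  | insert a s ha ih =>
    rw [Finset.prod_insert ha]
    exact (h a (Finset.mem_insert_self a s)).mul
      (ih fun i hi => h i (Finset.mem_insert_of_mem hi))

theorem coeff_pow_of_lt {Y : R⟦X⟧} (hY : constantCoeff Y = 0) {m n : ℕ} (h : m < n) :
    coeff m (Y ^ n) = 0 :=
  X_pow_dvd_iff.1 (pow_dvd_pow_of_dvd (X_dvd_iff.2 hY) n) m h

theorem coeff_subst_eq_sum_range (F : R⟦X⟧) {Y : R⟦X⟧} (hY : constantCoeff Y = 0) (m : ℕ) :
    coeff m (F.subst Y) = ∑ n ∈ Finset.range (m + 1), coeff n F * coeff m (Y ^ n) := by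
  rw [coeff_subst' (HasSubst.of_constantCoeff_zero' hY), finsum_eq_sum_of_support_subset]
  · rfl
  · intro n hn
    by_contra h
    refine hn ?_
    simp only
    rw [coeff_pow_of_lt hY (by simpa using h), smul_zero]

/-- As η has no constant term, T^m sees only the powers n ≤ m of the argument, and the n-th one
carries x^{un}. -/
theorem hasWeight_subst (F η : R⟦X⟧) (hη : constantCoeff η = 0) {u d : ℕ} (hu : u ≤ d) (c : R) :
    HasWeight d ((PowerSeries.map Polynomial.C F).subst
      (C (Polynomial.monomial u c) * PowerSeries.map Polynomial.C η)) := fun m => by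
  rw [coeff_subst_eq_sum_range]
  · refine Polynomial.natDegree_sum_le_of_forall_le _ _ fun n hn => ?_
    rw [coeff_map, mul_pow, ← map_pow C, ← map_pow (PowerSeries.map _), coeff_C_mul, coeff_map]
    refine (Polynomial.natDegree_C_mul_le _ _).trans <| (Polynomial.natDegree_mul_C_le _ _).trans <|
      Polynomial.natDegree_pow_le.trans ?_
    rw [mul_comm]
    exact Nat.mul_le_mul ((Polynomial.natDegree_monomial_le _).trans hu)
      (Nat.lt_succ_iff.1 (Finset.mem_range.1 hn))
  · rw [map_mul, ← coeff_zero_eq_constantCoeff_apply (PowerSeries.map _ η), coeff_map,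
      coeff_zero_eq_constantCoeff_apply, hη]
    simp

end Swap

/-! ### Infinite products of bounded weight -/

section InfiniteProduct

variable {R : Type*} [CommRing R] {p : ℕ}

theorem natCast_pow_dvd_iff_coeff {N : ℕ} {g : Polynomial R} :
    (p : Polynomial R) ^ N ∣ g ↔ ∀ c, (p : R) ^ N ∣ g.coeff c := by
  rw [← Polynomial.C_dvd_iff_dvd_coeff, map_pow, map_natCast]

/-- An infinite product whose factors tend to `1` coefficientwise `p`-adically converges, and the
limit keeps the bound on the degrees. -/
theorem exists_limit_prod [IsPrecomplete (Ideal.span {(p : R)}) R] {d : ℕ}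
    (F : ℕ → (Polynomial R)⟦X⟧) (hw : ∀ i, HasWeight d (F i)) (I : ℕ → ℕ)
    (hF : ∀ N i, I N ≤ i → F i - 1 ∈ smallIdeal p N (Polynomial R)) :
    ∃ E : (Polynomial R)⟦X⟧, HasWeight d E ∧ ∀ N, ∃ n, ∀ s, Finset.range n ⊆ s →
      E - ∏ i ∈ s, F i ∈ smallIdeal p N (Polynomial R) := by
  -- A monotone threshold above I.
  set g : ℕ → ℕ := fun n => ∑ k ∈ Finset.range (n + 1), I k with hg
  have hgI : ∀ n, I n ≤ g n := fun n =>
    Finset.single_le_sum (f := I) (fun _ _ => Nat.zero_le _) (Finset.self_mem_range_succ n)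
  have hgm : Monotone g := fun a b h =>
    Finset.sum_le_sum_of_subset (Finset.range_subset_range.2 (Nat.add_le_add_right h 1))
  have hdiff : ∀ N s, Finset.range (g N) ⊆ s →
      ∏ i ∈ s, F i - ∏ i ∈ Finset.range (g N), F i ∈ smallIdeal p N (Polynomial R) := by
    intro N s hs
    rw [← Finset.prod_sdiff hs, ← sub_one_mul]
    refine Ideal.mul_mem_right _ _ (prod_sub_one_mem _ _ _ fun i hi => hF N i ?_)
    exact (hgI N).trans (by simpa using (Finset.mem_sdiff.1 hi).2)
  set P : ℕ → (Polynomial R)⟦X⟧ := fun n => ∏ i ∈ Finset.range (g n), F i with hP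
  have hPw : ∀ n, HasWeight d (P n) := fun n => hasWeight_prod _ _ fun i _ => hw i
  have hPd : ∀ m c n n', m < n → n ≤ n' →
      (p : R) ^ n ∣ (coeff m (P n')).coeff c - (coeff m (P n)).coeff c := by
    intro m c n n' hm hn
    have h1 := hdiff n (Finset.range (g n')) (Finset.range_subset_range.2 (hgm hn)) m hm
    have h2 := natCast_pow_dvd_iff_coeff.1 h1 c
    rwa [map_sub, Polynomial.coeff_sub] at h2
  -- The shift by m + 1 is needed because the ideal at level n controls only the coefficients of T^m
  -- with m < n.
  have hlim : ∀ m c, ∃ l : R, ∀ n, (p : R) ^ n ∣ (coeff m (P (n + (m + 1)))).coeff c - l := by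
    intro m c
    obtain ⟨l, hl⟩ := IsPrecomplete.prec (I := Ideal.span {(p : R)}) (M := R) inferInstance
      (f := fun n => (coeff m (P (n + (m + 1)))).coeff c) (by
        intro n n' hn
        rw [SModEq.sub_mem, smul_eq_mul, Ideal.mul_top, Ideal.span_singleton_pow,
          Ideal.mem_span_singleton, ← neg_sub, dvd_neg]
        exact (pow_dvd_pow _ (Nat.le_add_right _ _)).trans
          (hPd m c (n + (m + 1)) (n' + (m + 1)) (by omega) (by omega)))
    refine ⟨l, fun n => ?_⟩
    have := hl n
    rwa [SModEq.sub_mem, smul_eq_mul, Ideal.mul_top, Ideal.span_singleton_pow,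
      Ideal.mem_span_singleton] at this
  choose l hl using hlim
  -- Cutting at degree dm makes the coefficient a polynomial and loses nothing: the partial products
  -- vanish beyond it.
  set E : (Polynomial R)⟦X⟧ := PowerSeries.mk fun m =>
    ∑ c ∈ Finset.range (d * m + 1), Polynomial.monomial c (l m c) with hE
  have hEc : ∀ m c, (coeff m E).coeff c = if c < d * m + 1 then l m c else 0 := by
    intro m c
    rw [hE, coeff_mk, Polynomial.finsetSum_coeff]
    simp only [Polynomial.coeff_monomial]
    rw [Finset.sum_ite_eq' (Finset.range (d * m + 1)) c (fun c => l m c)]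
    simp
  have hEP : ∀ N, E - P N ∈ smallIdeal p N (Polynomial R) := by
    intro N m hm
    rw [natCast_pow_dvd_iff_coeff]
    intro c
    rw [map_sub, Polynomial.coeff_sub, hEc]
    split_ifs with hc
    · have h1 := hl m c N
      have h2 := hPd m c N (N + (m + 1)) hm (Nat.le_add_right _ _)
      have h3 := dvd_sub h2 h1
      rwa [sub_sub_sub_cancel_left] at h3
    · rw [Polynomial.coeff_eq_zero_of_natDegree_lt ((hPw N m).trans_lt (by omega)), sub_zero]
      exact dvd_zero _
  refine ⟨E, fun m => ?_, fun N => ⟨g N, fun s hs => ?_⟩⟩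
  · rw [hE, coeff_mk]
    refine Polynomial.natDegree_sum_le_of_forall_le _ _ fun c hc => ?_
    exact (Polynomial.natDegree_monomial_le _).trans (Nat.lt_succ_iff.1 (Finset.mem_range.1 hc))
  · have := sub_mem (hEP N) (hdiff N s hs)
    rwa [sub_sub_sub_cancel_right] at this

end InfiniteProduct

/-! ### Convergence of E_f(x) -/

section Splitting

variable (p : ℕ) [Fact p.Prime] {K : Type*} [Field K] [CharP K p]

open scoped PowerSeries.WithPiTopology

/-- The canonical map `ℤ_p → W(K)[x]`. -/
noncomputable def padicIntToPoly (K : Type*) [Field K] [CharP K p] :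
    ℤ_[p] →+* Polynomial (WittVector p K) :=
  Polynomial.C.comp (padicIntToWitt p)

/-- The value `E(η c x ^ u)` in `W(K)[x]⟦T⟧`. -/
noncomputable def polyFactor (η : ℤ_[p]⟦X⟧) (c : WittVector p K) (u : ℕ) :
    (Polynomial (WittVector p K))⟦X⟧ :=
  (PowerSeries.map (padicIntToPoly p K) (artinHasse p)).subst
    (C (Polynomial.monomial u c) * PowerSeries.map (padicIntToPoly p K) η)

theorem map_padicIntToPoly (η : ℤ_[p]⟦X⟧) : PowerSeries.map (padicIntToPoly p K) η =
    PowerSeries.map Polynomial.C (PowerSeries.map (padicIntToWitt p) η) := by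
  ext n : 1
  simp [padicIntToPoly]

theorem constantCoeff_map_of_eq_zero {A B : Type*} [CommRing A] [CommRing B] (φ : A →+* B)
    {η : A⟦X⟧} (hη : constantCoeff η = 0) : constantCoeff (PowerSeries.map φ η) = 0 := by
  rw [← coeff_zero_eq_constantCoeff_apply, coeff_map, coeff_zero_eq_constantCoeff_apply, hη,
    map_zero]

theorem constantCoeff_mul_map_of_eq_zero {A B : Type*} [CommRing A] [CommRing B] (φ : A →+* B)
    {η : A⟦X⟧} (hη : constantCoeff η = 0) (F : B⟦X⟧) :
    constantCoeff (F * PowerSeries.map φ η) = 0 := by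
  rw [map_mul, constantCoeff_map_of_eq_zero φ hη, mul_zero]

/-- Y is divisible by T, so the topological sum is finite in each coefficient and agrees with formal
substitution. -/
theorem artinHasseEval_swap [PerfectRing K p] {Y : (Polynomial (WittVector p K))⟦X⟧}
    (hY : constantCoeff Y = 0) : artinHasseEval p (swap _ Y) =
      swap _ ((PowerSeries.map (padicIntToPoly p K) (artinHasse p)).subst Y) := by
  let : TopologicalSpace (WittVector p K) := wittTopology p K
  have := t2Space_wittTopology p (L := K)
  refine HasSum.tsum_eq ?_
  rw [WithPiTopology.hasSum_iff_hasSum_coeff]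
  intro N
  rw [WithPiTopology.hasSum_iff_hasSum_coeff]
  intro m
  have hterm : ∀ n, coeff m (coeff N (C (C (padicIntToWitt p (coeff n (artinHasse p)))) *
      swap _ Y ^ n)) =
      (coeff n (PowerSeries.map (padicIntToPoly p K) (artinHasse p)) * coeff m (Y ^ n)).coeff N := by
    intro n
    rw [← map_pow, coeff_C_mul, coeff_C_mul, coeff_coeff_swap, coeff_map, padicIntToPoly,
      RingHom.comp_apply, Polynomial.coeff_C_mul]
  simp only [hterm]
  rw [coeff_coeff_swap, coeff_subst_eq_sum_range _ hY, Polynomial.finsetSum_coeff]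
  refine hasSum_sum_of_ne_finset_zero fun n hn => ?_
  rw [coeff_pow_of_lt hY (by simpa using hn), mul_zero, Polynomial.coeff_zero]

theorem splitFactor_eq_swap [PerfectRing K p] (h : Polynomial K) {η : ℤ_[p]⟦X⟧}
    (hη : constantCoeff η = 0) : splitFactor p h η =
      swap _ (∏ u ∈ Finset.range (h.natDegree + 1),
        polyFactor p η (WittVector.teichmuller p (h.coeff u)) u) := by
  rw [splitFactor, map_prod]
  refine Finset.prod_congr rfl fun u _ => ?_
  rw [polyFactor, ← artinHasseEval_swap p (constantCoeff_mul_map_of_eq_zero _ hη _), map_mul (swap _),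
    swap_C_monomial, map_padicIntToPoly, swap_map_C]
  congr 1
  rw [map_mul]
  ring

theorem hasWeight_polyFactor {η : ℤ_[p]⟦X⟧} (hη : constantCoeff η = 0) (c : WittVector p K)
    {u d : ℕ} (hu : u ≤ d) : HasWeight d (polyFactor p η c u) := by
  rw [polyFactor, map_padicIntToPoly, map_padicIntToPoly]
  exact hasWeight_subst _ _ (constantCoeff_map_of_eq_zero _ hη) hu c

theorem polyFactor_sub_one_mem {η : ℤ_[p]⟦X⟧} (hη : constantCoeff η = 0) {N : ℕ}
    (h : η ∈ smallIdeal p N ℤ_[p]) (c : WittVector p K) (u : ℕ) :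
    polyFactor p η c u - 1 ∈ smallIdeal p N (Polynomial (WittVector p K)) := by
  have h1 := subst_sub_C_mem_smallIdeal (p := p) (N := N)
    (PowerSeries.map (padicIntToPoly p K) (artinHasse p))
    (HasSubst.of_constantCoeff_zero' (constantCoeff_mul_map_of_eq_zero (padicIntToPoly p K) hη
      (C (Polynomial.monomial u c)))) (Ideal.mul_mem_left _ _ (map_mem_smallIdeal _ h))
  rwa [← coeff_zero_eq_constantCoeff_apply, coeff_map, coeff_zero_eq_constantCoeff_apply,
    constantCoeff_artinHasse, map_one, map_one] at h1

/-- The factor `E_{f_i}(x, π_i)` in `W(K)[x]⟦T⟧`. -/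
noncomputable def polySplitFactor (f : ℕ → Polynomial K) (i : ℕ) :
    (Polynomial (WittVector p K))⟦X⟧ :=
  ∏ u ∈ Finset.range ((f i).natDegree + 1),
    polyFactor p (piSeries p i) (WittVector.teichmuller p ((f i).coeff u)) u

theorem hasProd_of_smallIdeal {L : Type*} [Field L]
    {F : ℕ → (Polynomial (WittVector p L))⟦X⟧}
    {E : (Polynomial (WittVector p L))⟦X⟧}
    (h : ∀ N, ∃ n, ∀ s, Finset.range n ⊆ s →
      E - ∏ i ∈ s, F i ∈ smallIdeal p N (Polynomial (WittVector p L))) :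
    letI : TopologicalSpace (WittVector p L) := wittTopology p L
    HasProd (fun i => swap _ (F i)) (swap _ E) := by
  let : TopologicalSpace (WittVector p L) := wittTopology p L
  simp only [HasProd, SummationFilter.unconditional_filter, ← map_prod]
  rw [WithPiTopology.tendsto_iff_coeff_tendsto]
  intro N
  rw [WithPiTopology.tendsto_iff_coeff_tendsto]
  intro m
  refine ((Ideal.span {(p : WittVector p L)}).hasBasis_nhds_adic _).tendsto_right_iff.2 fun k _ => ?_
  obtain ⟨n, hn⟩ := h (k + (m + 1))
  refine Filter.eventually_atTop.2 ⟨Finset.range n, fun s hs => ?_⟩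
  refine ⟨coeff m (coeff N (swap _ (∏ i ∈ s, F i))) - coeff m (coeff N (swap _ E)), ?_, by simp⟩
  rw [Ideal.span_singleton_pow, SetLike.mem_coe, Ideal.mem_span_singleton, ← neg_sub, dvd_neg,
    coeff_coeff_swap, coeff_coeff_swap]
  have h1 := natCast_pow_dvd_iff_coeff.1 (hn s hs m (by omega)) N
  rw [map_sub, Polynomial.coeff_sub] at h1
  exact (pow_dvd_pow _ (Nat.le_add_right _ _)).trans h1

/-- The product defining `E_f(x)` converges to a series in `W(K)[x]⟦T⟧` whose coefficients have
degrees bounded by multiples of `d`. -/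
theorem exists_splitSeries [PerfectRing K p] (f : ℕ → Polynomial K) {d : ℕ}
    (hd : ∀ i, (f i).natDegree ≤ d) :
    ∃ E : (Polynomial (WittVector p K))⟦X⟧, HasWeight d E ∧
      (∀ N, ∃ n, ∀ s, Finset.range n ⊆ s → E - ∏ i ∈ s, polySplitFactor p f i ∈
        smallIdeal p N (Polynomial (WittVector p K))) ∧
      SplitConverges p f ∧ splitSeries p f = swap _ E := by
  obtain ⟨E, hE, hlim⟩ := exists_limit_prod (p := p) (d := d) (polySplitFactor p f)
    (fun i => hasWeight_prod _ _ fun u hu => hasWeight_polyFactor p (constantCoeff_piSeries p i) _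
      ((Nat.lt_succ_iff.1 (Finset.mem_range.1 hu)).trans (hd i))) (fun N => N + N)
    (fun N i hi => prod_sub_one_mem _ _ _ fun u _ =>
      polyFactor_sub_one_mem p (constantCoeff_piSeries p i) (piSeries_mem_smallIdeal p hi) _ _)
  let : TopologicalSpace (WittVector p K) := wittTopology p K
  have := t2Space_wittTopology p (L := K)
  have hprod : HasProd (fun i => splitFactor p (f i) (piSeries p i)) (swap _ E) := by
    simp only [splitFactor_eq_swap p _ (constantCoeff_piSeries p _)]
    exact hasProd_of_smallIdeal p hlim
  exact ⟨E, hE, hlim, hprod.multipliable, hprod.tprod_eq⟩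

end Splitting

/-! ### Commuting φ_p with multiplication -/

section PhiP

variable {R : Type*} [CommRing R] {p : ℕ}

/-- The rule F · φ_p(G) = φ_p(F(x^p) G), with F' in the role of F(x^p). -/
theorem coeff_mul_phiP (hp : p ≠ 0) {F F' : R⟦X⟧} (h1 : ∀ n, coeff (p * n) F' = coeff n F)
    (h2 : ∀ n, ¬p ∣ n → coeff n F' = 0) (G : R⟦X⟧) (u : ℕ) :
    coeff u (F * phiP p G) = coeff (p * u) (F' * G) := by
  rw [coeff_mul, coeff_mul]
  refine Finset.sum_of_injOn (fun x => (p * x.1, p * x.2)) ?_ ?_ ?_ ?_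
  · rintro ⟨a, b⟩ - ⟨c, d⟩ - h
    simp only [Prod.mk.injEq] at h
    exact Prod.ext (Nat.eq_of_mul_eq_mul_left (Nat.pos_of_ne_zero hp) h.1)
      (Nat.eq_of_mul_eq_mul_left (Nat.pos_of_ne_zero hp) h.2)
  · rintro ⟨a, b⟩ h
    have h := Finset.HasAntidiagonal.mem_antidiagonal.1 h
    refine Finset.HasAntidiagonal.mem_antidiagonal.2 ?_
    simp only at h ⊢
    rw [← mul_add, h]
  · rintro ⟨a, b⟩ h h'
    have h := Finset.HasAntidiagonal.mem_antidiagonal.1 h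
    simp only at h ⊢
    rw [h2, zero_mul]
    rintro ⟨c, rfl⟩
    have hb : p ∣ b := (Nat.dvd_add_right (dvd_mul_right p c)).1 (h ▸ dvd_mul_right p u)
    obtain ⟨e, rfl⟩ := hb
    refine h' ⟨(c, e), Finset.HasAntidiagonal.mem_antidiagonal.2 ?_, rfl⟩
    rw [← mul_add] at h
    exact Nat.eq_of_mul_eq_mul_left (Nat.pos_of_ne_zero hp) h
  · rintro ⟨a, b⟩ -
    rw [h1, phiP, coeff_mk]

end PhiP

/-! ### Iterates of the Dwork operator -/

section DworkOperator

variable (p : ℕ) [Fact p.Prime] {K : Type*} [Field K] [CharP K p]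

/-- The endomorphism `∑ c_n x ^ n ↦ ∑ σ^j(c_n) x ^ (p ^ j n)` of `W(K)[x]`. -/
noncomputable def polyFrob (K : Type*) [Field K] [CharP K p] (j : ℕ) :
    Polynomial (WittVector p K) →+* Polynomial (WittVector p K) :=
  ((Polynomial.expand (WittVector p K) (p ^ j)) : Polynomial (WittVector p K) →+* _).comp
    (Polynomial.mapRingHom (frobPow p K j))

theorem polyFrob_apply (j : ℕ) (g : Polynomial (WittVector p K)) :
    polyFrob p K j g = Polynomial.expand _ (p ^ j) (g.map (frobPow p K j)) := rfl

theorem polyFrob_zero : polyFrob p K 0 = RingHom.id _ := by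
  ext g
  · simp [polyFrob_apply, frobPow]
  · simp [polyFrob_apply]

theorem frobPow_succ_apply (j : ℕ) (w : WittVector p K) :
    frobPow p K (j + 1) w = WittVector.frobenius (frobPow p K j w) := by
  rw [frobPow_apply, frobPow_apply, Function.iterate_succ_apply']

theorem polyFrob_one_comp (j : ℕ) :
    (polyFrob p K 1).comp (polyFrob p K j) = polyFrob p K (j + 1) := by
  refine Polynomial.ringHom_ext (fun c => ?_) ?_
  · simp only [RingHom.comp_apply, polyFrob_apply, Polynomial.map_C, Polynomial.expand_C]
    rw [frobPow_succ_apply p j c, frobPow_apply p 1]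
    rfl
  · simp only [RingHom.comp_apply, polyFrob_apply, Polynomial.map_X, Polynomial.expand_X,
      map_pow]
    rw [← pow_mul, pow_one, ← pow_succ']

/-- The product of the series `σ^j(E)(x ^ (p ^ j))` over `j < r`. -/
noncomputable def frobProd (E : (Polynomial (WittVector p K))⟦X⟧) (r : ℕ) :
    (Polynomial (WittVector p K))⟦X⟧ :=
  ∏ j ∈ Finset.range r, PowerSeries.map (polyFrob p K j) E

theorem frobProd_succ (E : (Polynomial (WittVector p K))⟦X⟧) (r : ℕ) :
    frobProd p E (r + 1) = PowerSeries.map (polyFrob p K 1) (frobProd p E r) * E := by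
  rw [frobProd, Finset.prod_range_succ', frobProd, map_prod, polyFrob_zero]
  congr 1
  · refine Finset.prod_congr rfl fun j _ => ?_
    rw [← polyFrob_one_comp]
    ext m : 1
    simp

/-- The largest exponent substituted is p^{r-1}, against p^r in the index of φ_p^r; the spare factor
p is the source of the decay. -/
theorem hasWeight_frobProd {E : (Polynomial (WittVector p K))⟦X⟧} {d : ℕ} (hE : HasWeight d E)
    (r : ℕ) : HasWeight (d * p ^ (r - 1)) (frobProd p E r) := by
  refine hasWeight_prod _ _ fun j hj m => ?_
  rw [coeff_map, polyFrob_apply, Polynomial.natDegree_expand]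
  have hj := Finset.mem_range.1 hj
  calc _ ≤ d * m * p ^ j :=
        Nat.mul_le_mul_right _ (Polynomial.natDegree_map_le.trans (hE m))
    _ ≤ d * m * p ^ (r - 1) := Nat.mul_le_mul_left _
        (Nat.pow_le_pow_right (Fact.out : p.Prime).pos (by omega))
    _ = d * p ^ (r - 1) * m := by ring

variable [PerfectRing K p]

theorem frobenius_coeff_dworkOp (f : ℕ → Polynomial K) (g : (WittVector p K)⟦X⟧⟦X⟧) :
    PowerSeries.map (PowerSeries.map WittVector.frobenius) (dworkOp p f g) =
      phiP p (splitSeries p f * g) := by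
  ext u m : 2
  simp only [dworkOp, coeff_map]
  exact (WittVector.frobeniusEquiv p K).apply_symm_apply _

/-- φ^r = σ^{-r} ∘ φ_p^r ∘ F_r, obtained by moving each multiplication past φ_p. Applying σ^r to
both sides avoids inverses of Frobenius. -/
theorem map_frobPow_coeff_dworkOp_iterate {f : ℕ → Polynomial K}
    {E : (Polynomial (WittVector p K))⟦X⟧} (hE : splitSeries p f = swap _ E) (r : ℕ)
    (g : (WittVector p K)⟦X⟧⟦X⟧) (u : ℕ) :
    PowerSeries.map (frobPow p K r) (coeff u ((dworkOp p f)^[r] g)) =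
      coeff (p ^ r * u) (swap _ (frobProd p E r) * g) := by
  induction r generalizing g u with
  | zero =>
    ext m : 1
    simp [frobProd, frobPow]
  | succ r ih =>
    have h1 : PowerSeries.map (frobPow p K (r + 1)) (coeff u ((dworkOp p f)^[r + 1] g)) =
        PowerSeries.map WittVector.frobenius
          (coeff (p ^ r * u) (swap _ (frobProd p E r) * dworkOp p f g)) := by
      rw [← ih, Function.iterate_succ_apply]
      ext m : 1
      simp only [coeff_map]
      exact frobPow_succ_apply p r _
    rw [h1, ← coeff_map, map_mul, frobenius_coeff_dworkOp,
      coeff_mul_phiP (Fact.out : p.Prime).ne_zero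
        (F' := swap _ (PowerSeries.map (polyFrob p K 1) (frobProd p E r)))]
    · rw [hE, ← mul_assoc (swap _ _), ← map_mul, ← frobProd_succ, ← mul_assoc, pow_succ']
    · intro n
      ext m : 1
      rw [coeff_coeff_swap, coeff_map, polyFrob_apply, pow_one,
        mul_comm, Polynomial.coeff_expand_mul (Fact.out : p.Prime).pos, Polynomial.coeff_map,
        coeff_map, coeff_map, coeff_coeff_swap, frobPow_apply]
      rfl
    · intro n hn
      ext m : 1
      rw [coeff_coeff_swap, coeff_map, polyFrob_apply, pow_one,
        Polynomial.coeff_expand (Fact.out : p.Prime).pos, if_neg hn, map_zero]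

end DworkOperator

/-! ### The matrix of φ^a: powers and decay -/

section DworkMatrix

variable (p : ℕ) [Fact p.Prime] {K : Type*} [Field K] [Finite K] [CharP K p]
  {a : ℕ} (hK : Nat.card K = p ^ a) {f : ℕ → Polynomial K}
  {E : (Polynomial (WittVector p K))⟦X⟧} (hE : splitSeries p f = swap _ E)

include hK

theorem frobPow_mul_eq_id (k : ℕ) : frobPow p K (a * k) = RingHom.id _ := by
  rw [frobPow, pow_mul]
  have h := frobPow_eq_id p hK
  rw [frobPow] at h
  rw [h]
  exact one_pow k

include hE

theorem coeff_dworkOp_iterate (k : ℕ) (g : (WittVector p K)⟦X⟧⟦X⟧) (u : ℕ) :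
    coeff u ((dworkOp p f)^[a * k] g) =
      coeff (p ^ (a * k) * u) (swap _ (frobProd p E (a * k)) * g) := by
  rw [← map_frobPow_coeff_dworkOp_iterate p hE, frobPow_mul_eq_id p hK, map_id]
  rfl

theorem dworkMatrix_apply (k u v : ℕ) : dworkMatrix p f (a * k) u v =
    if v ≤ p ^ (a * k) * u then
      coeff (p ^ (a * k) * u - v) (swap _ (frobProd p E (a * k))) else 0 := by
  rw [dworkMatrix, Matrix.of_apply, coeff_dworkOp_iterate p hK hE, coeff_mul_X_pow']

/-- Since σ^a = 1, the coefficient of x^u in φ^a(g) is row u of the matrix applied to the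
coefficients of g; that row stops at column p^a u because F_a has no negative powers of x. -/
theorem isPowers_dworkMatrix : IsPowers (fun u => p ^ a * u + 1) (dworkMatrix p f a)
    (fun k => dworkMatrix p f (a * k)) where
  one := by simp only [mul_one]
  succ k u v := by
    have h1 : dworkMatrix p f (a * (k + 1)) u v =
        coeff u ((dworkOp p f)^[a * 1] ((dworkOp p f)^[a * k] (X ^ v))) := by
      rw [← Function.iterate_add_apply, mul_one, mul_add, mul_one, add_comm]
      rfl
    rw [h1, coeff_dworkOp_iterate p hK hE, mul_comm (swap _ _), coeff_mul,
      Finset.Nat.sum_antidiagonal_eq_sum_range_succ_mk]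
    simp only [mul_one, Nat.succ_eq_add_one]
    refine Finset.sum_congr rfl fun w hw => ?_
    have h2 := dworkMatrix_apply p hK hE 1 u w
    rw [mul_one, if_pos (Nat.lt_succ_iff.1 (Finset.mem_range.1 hw))] at h2
    rw [h2, mul_comm]
    rfl
  row u w h := by
    have h2 := dworkMatrix_apply p hK hE 1 u w
    rwa [mul_one, if_neg (by omega)] at h2

/-- A nonzero entry forces p^a u - v ≤ d p^{a-1} m. Bounding v by p^{a-1} v and cancelling p^{a-1}
leaves pu ≤ dm + v, and p ≥ 2. -/
theorem decays_dworkMatrix (ha : a ≠ 0) {d : ℕ} (hd : HasWeight d E) :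
    Decays d (dworkMatrix p f a) := by
  intro u v m hm
  have hp := (Fact.out : p.Prime)
  have h := dworkMatrix_apply p hK hE 1 u v
  rw [mul_one] at h
  rw [h] at hm
  split_ifs at hm with hv
  · rw [coeff_coeff_swap] at hm
    have h1 := (Polynomial.le_natDegree_of_ne_zero hm).trans (hasWeight_frobProd p hd a m)
    obtain ⟨b, rfl⟩ := Nat.exists_eq_succ_of_ne_zero ha
    rw [Nat.succ_eq_add_one, Nat.add_sub_cancel, Nat.sub_le_iff_le_add, pow_succ] at h1
    have h2 : p ^ b * (p * u) ≤ p ^ b * (d * m + v) := by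
      have : v ≤ p ^ b * v := Nat.le_mul_of_pos_left _ (pow_pos hp.pos b)
      calc p ^ b * (p * u) = p ^ b * p * u := by ring
        _ ≤ d * p ^ b * m + v := h1
        _ ≤ d * p ^ b * m + p ^ b * v := by omega
        _ = p ^ b * (d * m + v) := by ring
    exact (Nat.mul_le_mul_right u hp.two_le).trans
      (Nat.le_of_mul_le_mul_left h2 (pow_pos hp.pos b))
  · simp at hm

end DworkMatrix

/-! ### Evaluating E_f at Teichmüller points -/

section Evaluation

variable (p : ℕ) [Fact p.Prime] {K L : Type*} [Field K] [CharP K p] [Field L] [CharP L p]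
  [Algebra K L]

theorem charZero_wittVector (L : Type*) [Field L] [CharP L p] : CharZero (WittVector p L) :=
  charZero_of_injective_ringHom (padicIntToWitt_injective p (L := L))

/-- Evaluation of polynomials over `W(K)` at the Teichmüller representative of `t` in `L`. -/
noncomputable def teichEval (K : Type*) [Field K] [CharP K p] [Algebra K L] (t : L) :
    Polynomial (WittVector p K) →+* WittVector p L :=
  Polynomial.eval₂RingHom (WittVector.map (algebraMap K L)) (WittVector.teichmuller p t)

theorem frobPow_map (j : ℕ) (w : WittVector p K) :
    WittVector.map (algebraMap K L) (frobPow p K j w) =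
      frobPow p L j (WittVector.map (algebraMap K L) w) := by
  induction j with
  | zero => simp [frobPow]
  | succ j ih =>
    rw [frobPow_succ_apply, frobPow_succ_apply, ← ih]
    ext n
    simp only [WittVector.map_coeff, WittVector.coeff_frobenius_charP, map_pow]

/-- Since σ^j(t̂) = t̂^{p^j}, substituting x^{p^j} and twisting the coefficients amounts to applying
σ^j to the value. -/
theorem teichEval_polyFrob (t : L) (j : ℕ) :
    (teichEval p K t).comp (polyFrob p K j) = (frobPow p L j).comp (teichEval p K t) := by
  refine Polynomial.ringHom_ext (fun c => ?_) ?_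
  · simp only [RingHom.comp_apply, polyFrob_apply, Polynomial.map_C, Polynomial.expand_C,
      teichEval, Polynomial.coe_eval₂RingHom, Polynomial.eval₂_C, frobPow_map]
  · simp only [RingHom.comp_apply, polyFrob_apply, Polynomial.map_X, Polynomial.expand_X,
      teichEval, Polynomial.coe_eval₂RingHom, Polynomial.eval₂_X, Polynomial.eval₂_X_pow,
      frobPow_teichmuller]

theorem map_teichEval_frobProd (t : L) (E : (Polynomial (WittVector p K))⟦X⟧) (r : ℕ) :
    PowerSeries.map (teichEval p K t) (frobProd p E r) =
      ∏ j ∈ Finset.range r,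
        PowerSeries.map (frobPow p L j) (PowerSeries.map (teichEval p K t) E) := by
  rw [frobProd, map_prod]
  refine Finset.prod_congr rfl fun j _ => ?_
  ext m : 1
  simp only [coeff_map]
  exact RingHom.congr_fun (teichEval_polyFrob p t j) _

theorem map_teichEval_polyFactor {η : ℤ_[p]⟦X⟧} (hη : constantCoeff η = 0) (c : K) (u : ℕ) (t : L)
    (j : ℕ) :
    PowerSeries.map (frobPow p L j) (PowerSeries.map (teichEval p K t)
      (polyFactor p η (WittVector.teichmuller p c) u)) =
      (PowerSeries.map (padicIntToWitt p : ℤ_[p] →+* WittVector p L) (artinHasse p)).subst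
        (C (WittVector.teichmuller p (algebraMap K L c * t ^ u) ^ p ^ j) *
          PowerSeries.map (padicIntToWitt p) η) := by
  have hs : HasSubst (C (Polynomial.monomial u (WittVector.teichmuller p c)) *
      PowerSeries.map (padicIntToPoly p K) η) :=
    HasSubst.of_constantCoeff_zero' (constantCoeff_mul_map_of_eq_zero _ hη _)
  have hcomp : ∀ F : ℤ_[p]⟦X⟧, PowerSeries.map ((frobPow p L j).comp (teichEval p K t))
      (PowerSeries.map (padicIntToPoly p K) F) = PowerSeries.map (padicIntToWitt p) F := by
    intro F
    ext n : 1
    simp only [coeff_map, padicIntToPoly, RingHom.comp_apply, teichEval,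
      Polynomial.coe_eval₂RingHom, Polynomial.eval₂_C, map_padicIntToWitt, frobPow_padicIntToWitt]
  rw [← RingHom.comp_apply (PowerSeries.map (frobPow p L j)), ← PowerSeries.map_comp, polyFactor]
  have h1 := map_subst (h := (frobPow p L j).comp (teichEval p K t)) hs
    (PowerSeries.map (padicIntToPoly p K) (artinHasse p))
  refine h1.trans ?_
  rw [hcomp]
  congr 1
  change PowerSeries.map _ _ = _
  rw [map_mul, hcomp, map_C]
  congr 2
  simp only [RingHom.comp_apply, teichEval, Polynomial.coe_eval₂RingHom, Polynomial.eval₂_monomial,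
    WittVector.map_teichmuller, ← map_pow, ← map_mul, frobPow_teichmuller]

theorem prod_binomialSeries {ι : Type*} (s : Finset ι) (w : ι → ℤ_[p]) :
    ∏ i ∈ s, binomialSeries ℤ_[p] (w i) = binomialSeries ℤ_[p] (∑ i ∈ s, w i) := by
  classical
  induction s using Finset.induction_on with
  | empty => simp
  | insert a s ha ih => rw [Finset.prod_insert ha, Finset.sum_insert ha, ih, binomialSeries_add]

theorem wittTrace_sum {ι : Type*} (s : Finset ι) (w : ι → WittVector p L) :
    wittTrace p (∑ i ∈ s, w i) = ∑ i ∈ s, wittTrace p (w i) := by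
  simp only [wittTrace, map_sum]

theorem eq_of_forall_sub_mem_smallIdeal [PerfectRing L p] {F G : (WittVector p L)⟦X⟧}
    (h : ∀ N, F - G ∈ smallIdeal p N (WittVector p L)) : F = G := by
  ext m : 1
  rw [← sub_eq_zero, ← map_sub]
  refine eq_zero_of_forall_pow_dvd (ϖ := (p : WittVector p L)) fun n => ?_
  exact (pow_dvd_pow _ (Nat.le_add_right n (m + 1))).trans (h (n + (m + 1)) m (by omega))

variable [Finite L] {r : ℕ} (hr : Nat.card L = p ^ r)

include hr in
theorem prod_frobPow_polyFactor (i : ℕ) (c : K) (u : ℕ) (t : L) :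
    ∏ j ∈ Finset.range r, PowerSeries.map (frobPow p L j) (PowerSeries.map (teichEval p K t)
      (polyFactor p (piSeries p i) (WittVector.teichmuller p c) u)) =
      PowerSeries.map (padicIntToWitt p) (binomialSeries ℤ_[p] ((p : ℤ_[p]) ^ i *
        wittTrace p (WittVector.teichmuller p (algebraMap K L c * t ^ u)))) := by
  have := charZero_wittVector p L
  have : Fintype L := Fintype.ofFinite L
  simp only [map_teichEval_polyFactor p (constantCoeff_piSeries p i)]
  have h1 := artinHasse_subst_piSeries p i
  have h2 := congrArg (PowerSeries.map (padicIntToWitt p : ℤ_[p] →+* WittVector p L)) h1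
  have h3 := map_subst (h := (padicIntToWitt p : ℤ_[p] →+* WittVector p L))
    (HasSubst.of_constantCoeff_zero' (constantCoeff_piSeries p i)) (artinHasse p)
  have h4 : (PowerSeries.map (padicIntToWitt p : ℤ_[p] →+* WittVector p L) (artinHasse p)).subst
      (PowerSeries.map (padicIntToWitt p) (piSeries p i)) = (1 + X : (WittVector p L)⟦X⟧) ^ p ^ i := by
    refine h3.symm.trans (h2.trans ?_)
    rw [map_pow, map_add, map_one, map_X]
  have h5 := prod_artinHasse_subst p (padicIntToWitt p : ℤ_[p] →+* WittVector p L)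
    (y := WittVector.teichmuller p (algebraMap K L c * t ^ u)) (r := r)
    (by rw [← map_pow, ← hr, Nat.card_eq_fintype_card, FiniteField.pow_card])
    (constantCoeff_map_of_eq_zero _ (constantCoeff_piSeries p i)) h4
    (z := wittTrace p (WittVector.teichmuller p (algebraMap K L c * t ^ u)))
    (by simp only [padicIntToWitt_wittTrace p hr, frobPow_teichmuller])
  rw [h5]
  push_cast
  rfl

include hr in
theorem prod_frobPow_prod_polySplitFactor (f : ℕ → Polynomial K) (t : L) (n : ℕ) :
    ∏ j ∈ Finset.range r, PowerSeries.map (frobPow p L j) (PowerSeries.map (teichEval p K t)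
      (∏ i ∈ Finset.range n, polySplitFactor p f i)) =
      PowerSeries.map (padicIntToWitt p) (binomialSeries ℤ_[p] (wittTrace p
        (∑ i ∈ Finset.range n, (p : WittVector p L) ^ i * (teichPoly p (f i)).eval₂
          (WittVector.map (algebraMap K L)) (WittVector.teichmuller p t)))) := by
  simp only [polySplitFactor, map_prod]
  rw [Finset.prod_comm, wittTrace_sum, ← prod_binomialSeries, map_prod]
  refine Finset.prod_congr rfl fun i _ => ?_
  rw [Finset.prod_comm, wittTrace_p_pow_mul, teichPoly_eval₂, wittTrace_sum, Finset.mul_sum,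
    ← prod_binomialSeries, map_prod]
  exact Finset.prod_congr rfl fun u _ => prod_frobPow_polyFactor p hr i _ u t

include hr in
/-- The values of the splitting series at Teichmüller representatives. -/
theorem map_teichEval_frobProd_eq (f : ℕ → Polynomial K) {E : (Polynomial (WittVector p K))⟦X⟧}
    (hE : ∀ N, ∃ n, ∀ s, Finset.range n ⊆ s → E - ∏ i ∈ s, polySplitFactor p f i ∈
        smallIdeal p N (Polynomial (WittVector p K))) (t : L) :
    PowerSeries.map (teichEval p K t) (frobProd p E r) =
      PowerSeries.map (padicIntToWitt p)
        (binomialSeries ℤ_[p] (wittTrace p (fHat p f (WittVector.teichmuller p t)))) := by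
  refine eq_of_forall_sub_mem_smallIdeal p fun N => ?_
  obtain ⟨n, hn⟩ := hE N
  -- n makes the partial product of E_f close enough; N + N makes the trace of the tail of f̂
  -- divisible by p^{2N}, as the binomial series congruence requires.
  set n' := n + (N + N)
  have h1 := hn (Finset.range n') (Finset.range_subset_range.2 (Nat.le_add_right _ _))
  rw [map_teichEval_frobProd]
  have h2 := prod_sub_prod_mem (smallIdeal p N (WittVector p L)) (Finset.range r)
    (fun j => PowerSeries.map (frobPow p L j) (PowerSeries.map (teichEval p K t) E))
    (fun j => PowerSeries.map (frobPow p L j) (PowerSeries.map (teichEval p K t)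
      (∏ i ∈ Finset.range n', polySplitFactor p f i))) (fun j _ => by
        rw [← map_sub, ← map_sub]
        exact map_mem_smallIdeal _ (map_mem_smallIdeal _ h1))
  rw [prod_frobPow_prod_polySplitFactor p hr] at h2
  obtain ⟨w, hw⟩ := p_pow_dvd_fHat_sub p f (WittVector.teichmuller p t : WittVector p L) n'
  have h3 := eq_add_of_sub_eq' hw
  have h4 : binomialSeries ℤ_[p] (wittTrace p (fHat p f (WittVector.teichmuller p t))) -
      binomialSeries ℤ_[p] (wittTrace p
        (∑ i ∈ Finset.range n', (p : WittVector p L) ^ i * (teichPoly p (f i)).eval₂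
          (WittVector.map (algebraMap K L)) (WittVector.teichmuller p t))) ∈
      smallIdeal p N ℤ_[p] := by
    rw [h3, wittTrace_add, binomialSeries_add, ← mul_sub_one, wittTrace_p_pow_mul]
    refine Ideal.mul_mem_left _ _ (binomialSeries_sub_one_mem_smallIdeal p ?_)
    exact (pow_dvd_pow _ (Nat.le_add_left _ _)).mul_right _
  have h5 := map_mem_smallIdeal (padicIntToWitt p : ℤ_[p] →+* WittVector p L) h4
  rw [map_sub] at h5
  have h6 := sub_mem h2 h5
  rwa [sub_sub_sub_cancel_right] at h6

end Evaluation

/-! ### The Dwork trace formula -/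

section TraceFormula

theorem sum_range_mul_ite_dvd {M : Type*} [AddCommMonoid M] {q : ℕ} (hq : 0 < q) (r : ℕ)
    (g : ℕ → M) : ∑ n ∈ Finset.range (q * r), (if q ∣ n then g n else 0) =
      ∑ u ∈ Finset.range r, g (q * u) := by
  symm
  refine Finset.sum_of_injOn (fun u => q * u) ?_ ?_ ?_ ?_
  · exact fun u _ v _ h => Nat.eq_of_mul_eq_mul_left hq h
  · intro u hu
    simpa [hq] using hu
  · rintro n hn h
    rw [if_neg]
    rintro ⟨u, rfl⟩
    exact h ⟨u, by simpa [hq] using hn, rfl⟩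
  · intro u _
    simp

variable (p : ℕ) [Fact p.Prime] {K : Type*} [Field K] [Finite K] [CharP K p]

/-- The trace of a power of a decaying Dwork operator. -/
noncomputable def dworkTrace (f : ℕ → Polynomial K) (d r : ℕ) : (WittVector p K)⟦X⟧ :=
  PowerSeries.mk fun m => ∑ u ∈ Finset.range (d * m + 1), coeff m (dworkMatrix p f r u u)

variable {a : ℕ} (hK : Nat.card K = p ^ a) {f : ℕ → Polynomial K}
  {E : (Polynomial (WittVector p K))⟦X⟧} (hE : splitSeries p f = swap _ E)

omit [Fact p.Prime] [CharP K p] in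
include hK in
theorem exponent_ne_zero : a ≠ 0 := by
  rintro rfl
  have := Finite.one_lt_card (α := K)
  simp [hK] at this

include hK hE

theorem coeff_dworkTrace {d : ℕ} (hd : HasWeight d E) (k m r : ℕ) (hr : d * m < r) :
    coeff m (dworkTrace p f d (a * (k + 1))) =
      ∑ u ∈ Finset.range r, coeff m (dworkMatrix p f (a * (k + 1)) u u) := by
  rw [dworkTrace, coeff_mk]
  refine Finset.sum_subset (Finset.range_subset_range.2 hr) fun u _ hu => ?_
  by_contra h
  have h1 := (isPowers_dworkMatrix p hK hE).decays
    (decays_dworkMatrix p hK hE (exponent_ne_zero p hK) hd) k u u m h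
  exact hu (Finset.mem_range.2 (by omega))

/-- The Dwork trace formula. -/
theorem card_sub_one_mul_dworkTrace {d : ℕ} (hd : HasWeight d E)
    (hlim : ∀ N, ∃ n, ∀ s, Finset.range n ⊆ s → E - ∏ i ∈ s, polySplitFactor p f i ∈
        smallIdeal p N (Polynomial (WittVector p K))) (k : ℕ) :
    ((Nat.card K ^ (k + 1) - 1 : ℕ) : (WittVector p K)⟦X⟧) * dworkTrace p f d (a * (k + 1)) =
      PowerSeries.map (padicIntToWitt p) (expSum p f (k + 1)) := by
  set L := FiniteField.Extension K p (k + 1) with hL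
  set ι := WittVector.map (p := p) (algebraMap K L) with hι
  have hinj : Function.Injective (PowerSeries.map ι) :=
    PowerSeries.map_injective _ (WittVector.map_injective _ (algebraMap K L).injective)
  have hcard : Nat.card L = Nat.card K ^ (k + 1) := FiniteField.natCard_extension K p (k + 1)
  have hr : Nat.card L = p ^ (a * (k + 1)) := by rw [hcard, hK, pow_mul]
  have : Fintype Lˣ := Fintype.ofFinite _
  set q := Nat.card L - 1 with hq
  have hq0 : 0 < q := Nat.sub_pos_of_lt Finite.one_lt_card
  set H := frobProd p E (a * (k + 1)) with hH
  apply hinj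
  ext m : 1
  -- Large enough for the truncated trace at T^m and for q r to exceed the degree of the polynomial
  -- being evaluated; here q denotes |L| - 1.
  set r := d * m + 1 + (coeff m H).natDegree with hrdef
  have hdeg : (coeff m H).natDegree < q * r :=
    lt_of_lt_of_le (by omega) (Nat.le_mul_of_pos_left r hq0)
  have hdiag : ∀ u, coeff m (dworkMatrix p f (a * (k + 1)) u u) = (coeff m H).coeff (q * u) := by
    intro u
    rw [dworkMatrix_apply p hK hE, if_pos (Nat.le_mul_of_pos_left u (pow_pos
      (Fact.out : p.Prime).pos _)), coeff_coeff_swap, ← hr, hq, Nat.sub_mul, one_mul]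
  have hleft : coeff m (PowerSeries.map ι (((Nat.card K ^ (k + 1) - 1 : ℕ) : (WittVector p K)⟦X⟧) *
      dworkTrace p f d (a * (k + 1)))) =
      (q : WittVector p L) * ∑ u ∈ Finset.range r, ι ((coeff m H).coeff (q * u)) := by
    rw [← hcard, ← hq, map_mul, map_natCast, ← map_natCast (C (R := WittVector p L)), coeff_C_mul,
      coeff_map, coeff_dworkTrace p hK hE hd k m r (by omega), map_sum]
    simp only [hdiag]
  have hright : coeff m (PowerSeries.map ι (PowerSeries.map (padicIntToWitt p)
      (expSum p f (k + 1)))) = ∑ t : Lˣ, teichEval p K (t : L) (coeff m H) := by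
    rw [coeff_map, coeff_map, hι, map_padicIntToWitt, expSum, ← hcard, sum_nthRootsFinset,
      map_sum, map_sum]
    refine Finset.sum_congr rfl fun t _ => ?_
    rw [← coeff_map, ← map_teichEval_frobProd_eq p hr f hlim, coeff_map]
  rw [hleft, hright]
  have hev : ∀ t : Lˣ, teichEval p K (t : L) (coeff m H) =
      ∑ n ∈ Finset.range (q * r), ι ((coeff m H).coeff n) *
        WittVector.teichmuller p (t : L) ^ n := by
    intro t
    rw [teichEval, Polynomial.coe_eval₂RingHom, Polynomial.eval₂_eq_sum_range' _ hdeg]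
  simp only [hev]
  -- After the interchange, orthogonality keeps exactly the exponents q u, which are the diagonal
  -- entries of `hdiag`.
  rw [Finset.sum_comm]
  simp only [← Finset.mul_sum, sum_teichmuller_pow, mul_ite, mul_zero]
  rw [sum_range_mul_ite_dvd hq0, Finset.mul_sum]
  exact Finset.sum_congr rfl fun u _ => mul_comm _ _

end TraceFormula

/-! ### Newton's identities for C_f and integrality -/

section CFunction

variable (p : ℕ) [Fact p.Prime] {K : Type*} [Field K] [Finite K] [CharP K p]

omit [CharP K p] in
theorem isUnit_card_pow_sub_one {a : ℕ} (hK : Nat.card K = p ^ a) (k : ℕ) :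
    IsUnit ((Nat.card K ^ (k + 1) - 1 : ℕ) : ℤ_[p]) := by
  rw [PadicInt.isUnit_iff]
  by_contra hne
  have h1 := (PadicInt.norm_intCast_lt_one_iff (p := p)
    (z := ((Nat.card K ^ (k + 1) - 1 : ℕ) : ℤ))).1
    (by simpa using lt_of_le_of_ne (PadicInt.norm_le_one _) hne)
  have h2 : p ∣ Nat.card K ^ (k + 1) - 1 := by exact_mod_cast h1
  have h3 : p ∣ Nat.card K ^ (k + 1) := by
    rw [hK, ← pow_mul]
    exact dvd_pow_self p (mul_ne_zero (exponent_ne_zero p hK) k.succ_ne_zero)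
  have h4 : 1 ≤ Nat.card K ^ (k + 1) := Nat.one_le_pow _ _ Nat.card_pos
  have h5 : p ∣ 1 := by
    have := Nat.dvd_sub h3 h2
    rwa [Nat.sub_sub_self h4] at this
  exact (Fact.out : p.Prime).one_lt.ne' (Nat.dvd_one.1 h5)

/-- The quotient `S_f(T, k + 1) / (q ^ (k + 1) - 1)` in `ℤ_p⟦T⟧`. -/
noncomputable def normalizedSum (f : ℕ → Polynomial K) (k : ℕ) : ℤ_[p]⟦X⟧ :=
  C (Ring.inverse ((Nat.card K ^ (k + 1) - 1 : ℕ) : ℤ_[p])) * expSum p f (k + 1)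

theorem card_sub_one_mul_normalizedSum {a : ℕ} (hK : Nat.card K = p ^ a) (f : ℕ → Polynomial K)
    (k : ℕ) : ((Nat.card K ^ (k + 1) - 1 : ℕ) : ℤ_[p]⟦X⟧) * normalizedSum p f k =
      expSum p f (k + 1) := by
  rw [normalizedSum, ← mul_assoc, ← map_natCast (C (R := ℤ_[p])), ← map_mul,
    Ring.mul_inverse_cancel _ (isUnit_card_pow_sub_one p hK k), map_one, one_mul]

theorem constantCoeff_cExponent (f : ℕ → Polynomial K) : constantCoeff (cExponent p f) = 0 := by
  rw [← coeff_zero_eq_constantCoeff_apply, cExponent, coeff_mk]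

theorem coeff_derivative_cExponent {a : ℕ} (hK : Nat.card K = p ^ a) (f : ℕ → Polynomial K)
    (k : ℕ) : coeff k (derivative _ (cExponent p f)) =
      -PowerSeries.map PadicInt.Coe.ringHom (normalizedSum p f k) := by
  have hn : ((k : ℚ_[p]) + 1) ≠ 0 := Nat.cast_add_one_ne_zero k
  have h1 : 1 ≤ Nat.card K ^ (k + 1) := Nat.one_le_pow _ _ Nat.card_pos
  have hc : ((Nat.card K : ℚ_[p]) ^ (k + 1) - 1) = ((Nat.card K ^ (k + 1) - 1 : ℕ) : ℚ_[p]) := by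
    push_cast [Nat.cast_sub h1]
    rfl
  have hq : ((Nat.card K ^ (k + 1) - 1 : ℕ) : ℚ_[p]) ≠ 0 := by
    have := (isUnit_card_pow_sub_one p hK k).ne_zero
    exact_mod_cast this
  have h0 : coeff (k + 1) (cExponent p f) =
      -(C (((k + 1 : ℕ) : ℚ_[p]) * ((Nat.card K : ℚ_[p]) ^ (k + 1) - 1))⁻¹ *
        PowerSeries.map PadicInt.Coe.ringHom (expSum p f (k + 1))) := by
    rw [cExponent, coeff_mk]
  rw [coeff_derivative, h0, ← card_sub_one_mul_normalizedSum p hK f k, map_mul,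
    map_natCast, hc, ← map_natCast (C (R := ℚ_[p])) (Nat.card K ^ (k + 1) - 1),
    ← map_natCast (C (R := ℚ_[p])) k, ← map_one (C (R := ℚ_[p])), ← map_add, ← mul_assoc,
    ← map_mul, neg_mul, mul_right_comm, ← map_mul]
  have h2 : (((k + 1 : ℕ) : ℚ_[p]) * ((Nat.card K ^ (k + 1) - 1 : ℕ) : ℚ_[p]))⁻¹ *
      ((Nat.card K ^ (k + 1) - 1 : ℕ) : ℚ_[p]) * ((k : ℚ_[p]) + 1) = 1 := by
    rw [Nat.cast_add_one k]
    field_simp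
  rw [h2, map_one, one_mul]

theorem coeff_zero_cFunction (f : ℕ → Polynomial K) : coeff 0 (cFunction p f) = 1 := by
  rw [cFunction, subst_eq_C_add_mul _
    (HasSubst.of_constantCoeff_zero' (constantCoeff_cExponent p f)),
    coeff_zero_eq_constantCoeff_apply, map_add, map_mul, constantCoeff_cExponent]
  simp

theorem succ_mul_coeff_cFunction {a : ℕ} (hK : Nat.card K = p ^ a) (f : ℕ → Polynomial K) (n : ℕ) :
    ((n : ℚ_[p]⟦X⟧) + 1) * coeff (n + 1) (cFunction p f) =
      -∑ i ∈ Finset.range (n + 1), PowerSeries.map PadicInt.Coe.ringHom (normalizedSum p f i) *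
        coeff (n - i) (cFunction p f) := by
  have h : derivative _ (cFunction p f) = derivative _ (cExponent p f) * cFunction p f := by
    rw [cFunction, derivative_subst
      (HasSubst.of_constantCoeff_zero' (constantCoeff_cExponent p f)), derivative_exp, mul_comm]
  have h1 := congrArg (coeff n) h
  rw [coeff_derivative, coeff_mul, Finset.Nat.sum_antidiagonal_eq_sum_range_succ_mk] at h1
  rw [mul_comm, h1, ← Finset.sum_neg_distrib]
  refine Finset.sum_congr rfl fun i _ => ?_
  rw [coeff_derivative_cExponent p hK, neg_mul]

theorem coeff_zero_fredholmDet {R : Type*} [CommRing R] {A : Matrix ℕ ℕ R⟦X⟧} {d : ℕ}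
    (hA : Decays d A) : coeff 0 (fredholmDet A) = 1 := by
  ext m
  rw [hA.coeff_coeff_fredholmDet 0 (Nat.lt_succ_self _), Finset.powersetCard_zero,
    Finset.sum_singleton, principalMinor, Matrix.det_isEmpty, pow_zero, one_mul]

omit [Finite K] in
/-- A sequence over `ℤ_p⟦T⟧` whose images over `ℚ_p` and `W(K)` satisfy the same Newton
identities. -/
theorem exists_common_coeff {s : ℕ → ℤ_[p]⟦X⟧} {c : ℕ → ℚ_[p]⟦X⟧} {D : ℕ → (WittVector p K)⟦X⟧}
    (hc0 : c 0 = 1) (hD0 : D 0 = 1)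
    (hc : ∀ n : ℕ, ((n : ℚ_[p]⟦X⟧) + 1) * c (n + 1) = -∑ i ∈ Finset.range (n + 1),
      PowerSeries.map PadicInt.Coe.ringHom (s i) * c (n - i))
    (hD : ∀ n : ℕ, ((n : (WittVector p K)⟦X⟧) + 1) * D (n + 1) = -∑ i ∈ Finset.range (n + 1),
      PowerSeries.map (padicIntToWitt p) (s i) * D (n - i)) (n : ℕ) :
    ∃ b : ℤ_[p]⟦X⟧, PowerSeries.map PadicInt.Coe.ringHom b = c n ∧
      PowerSeries.map (padicIntToWitt p) b = D n := by
  induction n using Nat.strong_induction_on with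
  | _ n ih =>
    cases n with
    | zero => exact ⟨1, by rw [map_one, hc0], by rw [map_one, hD0]⟩
    | succ n =>
      have h : ∀ i : ℕ, ∃ b : ℤ_[p]⟦X⟧, PowerSeries.map PadicInt.Coe.ringHom b = c (n - i) ∧
          PowerSeries.map (padicIntToWitt p) b = D (n - i) := fun i => ih _ (by omega)
      choose b hb1 hb2 using h
      set z : ℤ_[p]⟦X⟧ := -∑ i ∈ Finset.range (n + 1), s i * b i with hz
      have hz1 : PowerSeries.map PadicInt.Coe.ringHom z = ((n : ℚ_[p]⟦X⟧) + 1) * c (n + 1) := by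
        simp only [hz, hc, map_neg, map_sum, map_mul, hb1]
      have hz2 : PowerSeries.map (padicIntToWitt p) z =
          ((n : (WittVector p K)⟦X⟧) + 1) * D (n + 1) := by
        simp only [hz, hD, map_neg, map_sum, map_mul, hb2]
      -- The image of z in W(K)⟦T⟧ is (n + 1) D (n + 1), so divisibility holds there and descends to
      -- ℤ_p.
      have hdvd : ∀ m, ((n + 1 : ℕ) : ℤ_[p]) ∣ coeff m z := by
        intro m
        refine natCast_dvd_of_dvd_padicIntToWitt p (L := K) n.succ_ne_zero ?_
        rw [← coeff_map, hz2, ← Nat.cast_add_one, ← map_natCast (C (R := WittVector p K)),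
          coeff_C_mul]
        exact dvd_mul_right _ _
      choose e he using hdvd
      have hze : z = ((n + 1 : ℕ) : ℤ_[p]⟦X⟧) * PowerSeries.mk e := by
        ext m : 1
        rw [← map_natCast (C (R := ℤ_[p])), coeff_C_mul, coeff_mk, he]
      have hn1 : ((n : ℚ_[p]⟦X⟧) + 1) ≠ 0 := by
        rw [← Nat.cast_add_one, ← map_natCast (C (R := ℚ_[p]))]
        exact (map_ne_zero_iff _ C_injective).2 (Nat.cast_ne_zero.2 n.succ_ne_zero)
      have hn2 : ((n : (WittVector p K)⟦X⟧) + 1) ≠ 0 := by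
        have := charZero_wittVector p K
        rw [← Nat.cast_add_one, ← map_natCast (C (R := WittVector p K))]
        exact (map_ne_zero_iff _ C_injective).2 (Nat.cast_ne_zero.2 n.succ_ne_zero)
      refine ⟨PowerSeries.mk e, mul_left_cancel₀ hn1 ?_, mul_left_cancel₀ hn2 ?_⟩
      · rw [← hz1, hze, map_mul, map_natCast, Nat.cast_add_one]
      · rw [← hz2, hze, map_mul, map_natCast, Nat.cast_add_one]

end CFunction

/-! ### The analytic trace formula -/

section AnalyticTraceFormula

variable (p : ℕ) [Fact p.Prime] {K : Type*} [Field K] [Finite K] [CharP K p]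
  {a : ℕ} (hK : Nat.card K = p ^ a) {f : ℕ → Polynomial K}
  {E : (Polynomial (WittVector p K))⟦X⟧} (hE : splitSeries p f = swap _ E)

include hK hE

theorem dworkTrace_eq_map_normalizedSum {d : ℕ} (hd : HasWeight d E)
    (hlim : ∀ N, ∃ n, ∀ s, Finset.range n ⊆ s → E - ∏ i ∈ s, polySplitFactor p f i ∈
        smallIdeal p N (Polynomial (WittVector p K))) (k : ℕ) :
    dworkTrace p f d (a * (k + 1)) =
      PowerSeries.map (padicIntToWitt p) (normalizedSum p f k) := by
  have h0 : ((Nat.card K ^ (k + 1) - 1 : ℕ) : (WittVector p K)⟦X⟧) ≠ 0 := by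
    have h1 := ((isUnit_card_pow_sub_one p hK k).map
      (padicIntToWitt p : ℤ_[p] →+* WittVector p K)).map (C (R := WittVector p K))
    rw [map_natCast, map_natCast] at h1
    exact h1.ne_zero
  refine mul_left_cancel₀ h0 ?_
  rw [card_sub_one_mul_dworkTrace p hK hE hd hlim, ← card_sub_one_mul_normalizedSum p hK f k,
    map_mul, map_natCast]

theorem succ_mul_coeff_fredholmDet {d : ℕ} (hd : HasWeight d E)
    (hlim : ∀ N, ∃ n, ∀ s, Finset.range n ⊆ s → E - ∏ i ∈ s, polySplitFactor p f i ∈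
        smallIdeal p N (Polynomial (WittVector p K))) (n : ℕ) :
    ((n : (WittVector p K)⟦X⟧) + 1) * coeff (n + 1) (fredholmDet (dworkMatrix p f a)) =
      -∑ i ∈ Finset.range (n + 1), PowerSeries.map (padicIntToWitt p) (normalizedSum p f i) *
        coeff (n - i) (fredholmDet (dworkMatrix p f a)) := by
  have h := (isPowers_dworkMatrix p hK hE).newton
    (decays_dworkMatrix p hK hE (exponent_ne_zero p hK) hd)
    (t := fun k => dworkTrace p f d (a * k))
    (fun k m r hr => coeff_dworkTrace p hK hE hd k m r hr) n
  rw [h]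
  refine congrArg Neg.neg (Finset.sum_congr rfl fun i _ => ?_)
  rw [← dworkTrace_eq_map_normalizedSum p hK hE hd hlim]

/-- The analytic trace formula: a common integral form of `C_f(T, s)` and `det(I - s M ^ a)`. -/
theorem exists_integral_cFunction {d : ℕ} (hd : HasWeight d E)
    (hlim : ∀ N, ∃ n, ∀ s, Finset.range n ⊆ s → E - ∏ i ∈ s, polySplitFactor p f i ∈
        smallIdeal p N (Polynomial (WittVector p K))) :
    ∃ D : PowerSeries (PowerSeries ℤ_[p]),
      PowerSeries.map (PowerSeries.map PadicInt.Coe.ringHom) D = cFunction p f ∧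
      PowerSeries.map (PowerSeries.map (padicIntToWitt p)) D =
        fredholmDet (dworkMatrix p f a) := by
  choose b hb1 hb2 using exists_common_coeff p (s := normalizedSum p f)
    (c := fun n => coeff n (cFunction p f))
    (D := fun n => coeff n (fredholmDet (dworkMatrix p f a)))
    (coeff_zero_cFunction p f)
    (coeff_zero_fredholmDet (decays_dworkMatrix p hK hE (exponent_ne_zero p hK) hd))
    (succ_mul_coeff_cFunction p hK f) (succ_mul_coeff_fredholmDet p hK hE hd hlim)
  refine ⟨PowerSeries.mk b, ?_, ?_⟩
  · ext n : 1
    rw [coeff_map, coeff_mk, hb1]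
  · ext n : 1
    rw [coeff_map, coeff_mk, hb2]

omit [Finite K] hK hE in
theorem isTAdicEntire_of_map_eq_fredholmDet {D : PowerSeries (PowerSeries ℤ_[p])} {d : ℕ}
    {A : Matrix ℕ ℕ (WittVector p K)⟦X⟧} (hA : Decays d A)
    (hD : PowerSeries.map (PowerSeries.map (padicIntToWitt p)) D = fredholmDet A) :
    IsTAdicEntire D := by
  intro c
  -- Then n - 1 > 2dc, so every m < cn satisfies 2dm < n(n - 1) and the coefficient of T^m vanishes.
  filter_upwards [Filter.eventually_ge_atTop (2 * (d * c) + 2)] with n hn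
  refine nat_le_order _ _ fun m hm => ?_
  apply padicIntToWitt_injective p (L := K)
  rw [← coeff_map, ← coeff_map, hD, map_zero]
  refine hA.coeff_coeff_fredholmDet_eq_zero ?_
  calc 2 * (d * m) ≤ 2 * (d * (c * n)) :=
        Nat.mul_le_mul_left 2 (Nat.mul_le_mul_left d hm.le)
    _ = n * (2 * (d * c)) := by ring
    _ < n * (n - 1) := Nat.mul_lt_mul_of_pos_left (by omega) (by omega)

end AnalyticTraceFormula

end TAdicWitt

theorem theorem4 (p : ℕ) [Fact p.Prime] (a : ℕ) {K : Type*} [Field K] [Finite K] [CharP K p]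
    (hK : Nat.card K = p ^ a) (f : ℕ → Polynomial K) (hf₀ : 0 < (f 0).natDegree)
    (hf : BddAbove (Set.range fun i => (f i).natDegree)) :
    TAdicWitt.SplitConverges p f ∧
    TAdicWitt.HasFredholmDet (TAdicWitt.dworkMatrix p f a) ∧
    ∃ D : PowerSeries (PowerSeries ℤ_[p]),
      PowerSeries.map (PowerSeries.map PadicInt.Coe.ringHom) D = TAdicWitt.cFunction p f ∧
      PowerSeries.map (PowerSeries.map (TAdicWitt.padicIntToWitt p)) D =
        TAdicWitt.fredholmDet (TAdicWitt.dworkMatrix p f a) ∧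
      TAdicWitt.IsTAdicEntire D := by
  obtain ⟨d, hd⟩ := hf
  obtain ⟨E, hw, hlim, hconv, hE⟩ :=
    TAdicWitt.exists_splitSeries p f (d := d) fun i => hd (Set.mem_range_self i)
  have hA := TAdicWitt.decays_dworkMatrix p hK hE (TAdicWitt.exponent_ne_zero p hK) hw
  obtain ⟨D, h1, h2⟩ := TAdicWitt.exists_integral_cFunction p hK hE hw hlim
  exact ⟨hconv, hA.hasFredholmDet, D, h1, h2,
    TAdicWitt.isTAdicEntire_of_map_eq_fredholmDet p hA h2⟩
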